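/- **Conventions.** A metric measure space $(Z,d_Z,\mu_Z)$ is a non-empty separable metric space with a Borel regular outer measure $\mu_Z$ for which Borel sets are measurable and $0<\mu_Z(B)<\infty$ for every ball $B$. It is a length space if the distance of any two points is the infimum of the lengths of the rectifiable curves joining them. For a measurable $u:Z\to[-\infty,\infty]$, a Borel function $g:Z\to[0,\infty]$ is an upper gradient of $u$ if $|u(\gamma(b))-u(\gamma(a))|\le\int_\gamma g\,ds$ for every non-constant absolutely continuous curve $\gamma:[a,b]\to Z$ (the left side is $\infty$ if one of the two values is infinite). $D^{1,p}(Z)$ is the class of measurable $u:Z\to[-\infty,\infty]$ that are integrable over every ball and have an upper gradient in $L^p(Z)$, and $N^{1,p}(Z)=\{u\in D^{1,p}(Z):\int_Z|u|^p\,d\mu_Z<\infty\}$. $Z$ is a $(p,p)$-Sobolev–Poincaré space with constant $C>0$ if for all $u\in D^{1,p}(Z)$ and all upper gradients $g\in L^p(Z)$ of $u$ there is $c_u\in\mathbb R$ with $\|u-c_u\|_{L^p(Z)}\le C\|g\|_{L^p(Z)}$. $Z$ is an $\infty$-weak local $(p,p)$-Poincaré space if for every $x\in Z$ there are $C_x,r_x>0$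 such that, with $B=B_Z(x,r_x)$ and $u_B$ the mean value of $u$ over $B$, $\|u-u_B\|_{L^p(B)}\le C_x\|g\|_{L^p(Z)}$ for every $u$ that is integrable over every ball of $Z$ and every upper gradient $g$ of $u$. Fix a norm $\|\cdot\|$ on $\mathbb R^2$ with $\|(1,0)\|=\|(0,1)\|=1$ and $\|(a,c)\|\le\|(b,d)\|$ whenever $0\le a\le b$, $0\le c\le d$. For length spaces $X,Y$ and continuous $\varphi:X\to[0,\infty)$ put $$d_\varphi(p,q)=\inf_\gamma\int_a^b\big\|\big(|\gamma_X'(t)|,\ \varphi(\gamma_X(t))\,|\gamma_Y'(t)|\big)\big\|\,dt,$$ where $\gamma=(\gamma_X,\gamma_Y):[a,b]\to X\times Y$ runs over the absolutely continuous curves from $p$ to $q$ and $|\gamma_X'|,|\gamma_Y'|$ are metric speeds. The warped product $X\times_\varphi Y$ is the quotient of $X\times Y$ by the relation $d_\varphi(p,q)=0$, with the induced distance $d_\varphi$ and with the push-forward $\mu_\varphi$ of $\mu_X\times\mu_Y$ under the quotient map. **Theorem.** Let $(X,d_X,\mu_X)$ and $(Y,d_Y,\mu_Y)$ be length metric measure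 spaces, let $1\le p<\infty$, and let $\varphi:X\to[0,\infty)$ be continuous such that at least one of the following holds: (i) $\inf_X\varphi>0$; (ii) $\mu_Y(Y)<\infty$ and $\varphi(x)>0$ for $\mu_X$-a.e. $x\in X$. Suppose that 1. $X$ is a $(p,p)$-Sobolev–Poincaré space with constant $C_X$, and $\mu_X(X)=\infty$; 2. $Y$ is an $\infty$-weak local $(p,p)$-Poincaré space; 3. there is a measurable set $E\subset X$ with $\mu_X(E)>0$, $\varphi^{-p}\in L^\infty(E,\mu_X)$ and $\varphi^{-p}\notin L^1(E,\mu_X)$. Then $(X\times_\varphi Y,d_\varphi,\mu_\varphi)$ is a metric measure space and a $(p,p)$-Sobolev–Poincaré space with the same constant $C_X$, and $$D^{1,p}(X\times_\varphi Y)=N^{1,p}(X\times_\varphi Y)+\mathbb R.$$ -/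

import Mathlib

open Set Filter Topology MeasureTheory
open scoped ENNReal NNReal

namespace WarpedPI

/-! ### Absolutely continuous paths, metric speed, line integrals

Distances are written with `edist`, so that everything applies at once to metric spaces and to the
warped product, whose distance is defined as an infimum in `[0, ∞]`. A path `[a, b] → Z` is given by
a function `ℝ → Z` of which only the values on `[a, b]` matter. -/

section Paths

variable {Z : Type*} [PseudoEMetricSpace Z]

/-- `γ` restricted to `[a, b]` is an absolutely continuous path: it is continuous and rectifiable,
and its length function `t ↦ len (γ|[a, t])` is absolutely continuous on `[a, b]`. -/
def IsACPath (γ : ℝ → Z) (a b : ℝ) : Prop :=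
  ContinuousOn γ (Icc a b) ∧ eVariationOn γ (Icc a b) ≠ ∞ ∧
    AbsolutelyContinuousOnInterval (fun t => (eVariationOn γ (Icc a t)).toReal) a b

/-- The metric speed `|γ'(t)| = lim_{s → t} d(γ(s), γ(t)) / |s - t|`. The upper limit agrees with
the limit where the latter exists, hence at almost every `t` if `γ` is absolutely continuous. -/
noncomputable def metricSpeed (γ : ℝ → Z) (t : ℝ) : ℝ≥0∞ :=
  limsup (fun s => edist (γ s) (γ t) / edist s t) (𝓝[≠] t)

/-- The line integral `∫_γ g ds = ∫_a^b g(γ(t)) |γ'(t)| dt` over an absolutely continuous path. -/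
noncomputable def lineIntegral (g : Z → ℝ≥0∞) (γ : ℝ → Z) (a b : ℝ) : ℝ≥0∞ :=
  ∫⁻ t in Ioo a b, g (γ t) * metricSpeed γ t

variable (Z) in
/-- `Z` is a length space: the distance of two points is the infimum of the lengths of the
(rectifiable) paths that join them; a non-rectifiable path contributes `∞` to the infimum. -/
def IsLengthSpace : Prop :=
  ∀ x y : Z, edist x y = ⨅ γ : Path x y, eVariationOn γ univ

end Paths

/-! ### Metric measure spaces, Sobolev classes, Poincaré inequalities

A Borel regular outer measure is represented by its restriction to the Borel sets, a `Measure` on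
the Borel σ-algebra; its Carathéodory measurable sets are the `NullMeasurableSet`s, and its
measurable functions are the `AEMeasurable` ones. -/

section Spaces

variable {Z : Type*} [EMetricSpace Z] [MeasurableSpace Z]

/-- `Z` with its distance and the measure `μ` is a metric measure space: it is non-empty and
separable, distances are finite, and balls have positive and finite measure. -/
structure IsMetricMeasureSpace (μ : Measure Z) : Prop where
  nonempty : Nonempty Z
  edist_ne_top : ∀ x y : Z, edist x y ≠ ∞
  separable : TopologicalSpace.SeparableSpace Z
  ball_pos : ∀ (x : Z) (r : ℝ), 0 < r → 0 < μ (Metric.eball x (ENNReal.ofReal r))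
  ball_lt_top : ∀ (x : Z) (r : ℝ), 0 < r → μ (Metric.eball x (ENNReal.ofReal r)) < ∞

/-- `g : Z → [0, ∞]` is an upper gradient of `u : Z → [-∞, ∞]`: it is Borel, and
`|u(γ(b)) - u(γ(a))| ≤ ∫_γ g ds` for each non-constant absolutely continuous path `γ` on `[a, b]`.
The left side is `∞` if one of the two values is infinite. -/
def IsUpperGradient (u : Z → EReal) (g : Z → ℝ≥0∞) : Prop :=
  Measurable g ∧ ∀ (γ : ℝ → Z) (a b : ℝ), a < b → IsACPath γ a b →
    (∃ s ∈ Icc a b, ∃ t ∈ Icc a b, γ s ≠ γ t) →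
    (u (γ b) - u (γ a)).abs ≤ lineIntegral g γ a b

/-- `u` is measurable and integrable over every ball. -/
def IntegrableOverBalls (u : Z → EReal) (μ : Measure Z) : Prop :=
  AEMeasurable u μ ∧ ∀ (x : Z) (r : ℝ), 0 < r →
    ∫⁻ z in Metric.eball x (ENNReal.ofReal r), (u z).abs ∂μ < ∞

/-- The Dirichlet–Sobolev class `D^{1,p}(Z)`: functions integrable over balls which have an upper
gradient in `L^p(Z)`. -/
def dirichletSobolev (p : ℝ) (μ : Measure Z) : Set (Z → EReal) :=
  {u | IntegrableOverBalls u μ ∧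
    ∃ g : Z → ℝ≥0∞, IsUpperGradient u g ∧ eLpNorm g (ENNReal.ofReal p) μ < ∞}

/-- The Newtonian Sobolev class `N^{1,p}(Z)`: functions `u` in `D^{1,p}(Z)` with
`∫ |u|^p dμ < ∞`. -/
def newtonianSobolev (p : ℝ) (μ : Measure Z) : Set (Z → EReal) :=
  {u | u ∈ dirichletSobolev p μ ∧ ∫⁻ z, (u z).abs ^ p ∂μ < ∞}

/-- `Z` is a `(p, q)`-Sobolev–Poincaré space with constant `C`. -/
def IsSobolevPoincare (p q C : ℝ) (μ : Measure Z) : Prop :=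
  0 < C ∧ ∀ u ∈ dirichletSobolev q μ, ∀ g : Z → ℝ≥0∞, IsUpperGradient u g →
    eLpNorm g (ENNReal.ofReal q) μ < ∞ →
    ∃ c : ℝ, eLpNorm (fun z => (u z - (c : EReal)).abs) (ENNReal.ofReal p) μ ≤
      ENNReal.ofReal C * eLpNorm g (ENNReal.ofReal q) μ

/-- `Z` is an `∞`-weak local `(p, q)`-Poincaré space. -/
def IsWeakLocalPoincare (p q : ℝ) (μ : Measure Z) : Prop :=
  ∀ x : Z, ∃ C : ℝ, ∃ r : ℝ, 0 < C ∧ 0 < r ∧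
    ∀ u : Z → EReal, IntegrableOverBalls u μ → ∀ g : Z → ℝ≥0∞, IsUpperGradient u g →
      eLpNorm (fun z => (u z -
          ((⨍ w in Metric.eball x (ENNReal.ofReal r), (u w).toReal ∂μ : ℝ) : EReal)).abs)
        (ENNReal.ofReal p) (μ.restrict (Metric.eball x (ENNReal.ofReal r))) ≤
      ENNReal.ofReal C * eLpNorm g (ENNReal.ofReal q) μ

end Spaces

/-- A coordinate-increasing unitary norm on `ℝ²`. -/
structure IsProductNorm (N : Seminorm ℝ (ℝ × ℝ)) : Prop where
  eq_zero : ∀ v, N v = 0 → v = 0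
  mono : ∀ a b c d : ℝ, 0 ≤ a → a ≤ b → 0 ≤ c → c ≤ d → N (a, c) ≤ N (b, d)
  unit_left : N (1, 0) = 1
  unit_right : N (0, 1) = 1

/-! ### Elementary facts on paths, needed for the triangle inequality of the warped distance -/

section PathFacts

variable {Z : Type*} [PseudoEMetricSpace Z]

lemma ac_const (c a b : ℝ) : AbsolutelyContinuousOnInterval (fun _ : ℝ => c) a b :=
  ((LipschitzWith.const c).lipschitzOnWith (s := uIcc a b)).absolutelyContinuousOnInterval

lemma ac_glue {f : ℝ → ℝ} {a b c : ℝ} (hab : a ≤ b) (hbc : b ≤ c)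
    (h1 : AbsolutelyContinuousOnInterval f a b) (h2 : AbsolutelyContinuousOnInterval f b c) :
    AbsolutelyContinuousOnInterval f a c := by
  rw [absolutelyContinuousOnInterval_iff] at *
  intro ε hε
  obtain ⟨δ1, hδ1, H1⟩ := h1 (ε / 2) (by positivity)
  obtain ⟨δ2, hδ2, H2⟩ := h2 (ε / 2) (by positivity)
  refine ⟨min δ1 δ2, by positivity, ?_⟩
  rintro ⟨n, I⟩ ⟨hI1, hI2⟩ hlt
  simp only at hI1 hI2 hlt
  have key1 := H1 (n, fun i => (min (I i).1 b, min (I i).2 b)) (by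
    refine ⟨fun i hi => ?_, fun i hi j hj hij => ?_⟩
    · have := hI1 i hi
      simp only [uIcc_of_le hab, uIcc_of_le (hab.trans hbc), mem_Icc] at this ⊢
      grind
    · refine (hI2 hi hj hij).mono ?_ ?_ <;>
      · intro t ht
        simp only [uIoc, mem_Ioc] at ht ⊢
        grind) (by
    refine lt_of_le_of_lt (Finset.sum_le_sum fun i _ => ?_) (hlt.trans_le (min_le_left _ _))
    simp only [Real.dist_eq]
    grind)
  have key2 := H2 (n, fun i => (max (I i).1 b, max (I i).2 b)) (by
    refine ⟨fun i hi => ?_, fun i hi j hj hij => ?_⟩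
    · have := hI1 i hi
      simp only [uIcc_of_le hbc, uIcc_of_le (hab.trans hbc), mem_Icc] at this ⊢
      grind
    · refine (hI2 hi hj hij).mono ?_ ?_ <;>
      · intro t ht
        simp only [uIoc, mem_Ioc] at ht ⊢
        grind) (by
    refine lt_of_le_of_lt (Finset.sum_le_sum fun i _ => ?_) (hlt.trans_le (min_le_right _ _))
    simp only [Real.dist_eq]
    grind)
  simp only at key1 key2 ⊢
  have : ∑ i ∈ Finset.range n, dist (f (I i).1) (f (I i).2) ≤
      ∑ i ∈ Finset.range n, dist (f (min (I i).1 b)) (f (min (I i).2 b)) +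
      ∑ i ∈ Finset.range n, dist (f (max (I i).1 b)) (f (max (I i).2 b)) := by
    rw [← Finset.sum_add_distrib]
    refine Finset.sum_le_sum fun i _ => ?_
    rcases le_total (I i).1 b with h | h <;> rcases le_total (I i).2 b with h' | h' <;>
      simp only [min_eq_left, min_eq_right, max_eq_left, max_eq_right, h, h', dist_self,
        add_zero, zero_add, le_refl]
    · exact dist_triangle _ _ _
    · rw [add_comm]; exact dist_triangle _ _ _
  linarith

lemma ac_shift {f : ℝ → ℝ} {a b : ℝ} (s : ℝ) (h : AbsolutelyContinuousOnInterval f a b) :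
    AbsolutelyContinuousOnInterval (fun t => f (t + s)) (a - s) (b - s) := by
  rw [absolutelyContinuousOnInterval_iff] at *
  intro ε hε
  obtain ⟨δ, hδ, H⟩ := h ε hε
  refine ⟨δ, hδ, ?_⟩
  rintro ⟨n, I⟩ ⟨hI1, hI2⟩ hlt
  refine H (n, fun i => ((I i).1 + s, (I i).2 + s)) ⟨fun i hi => ?_, fun i hi j hj hij => ?_⟩ ?_
  · have := hI1 i hi
    simp only [uIcc, mem_Icc] at this ⊢
    grind
  · have := hI2 hi hj hij
    simp only [Function.onFun, uIoc, Set.Ioc_disjoint_Ioc] at this ⊢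
    grind
  · simpa using hlt

lemma ac_neg {f : ℝ → ℝ} {a b : ℝ} (h : AbsolutelyContinuousOnInterval f a b) :
    AbsolutelyContinuousOnInterval (fun t => f (-t)) (-b) (-a) := by
  rw [absolutelyContinuousOnInterval_iff] at *
  intro ε hε
  obtain ⟨δ, hδ, H⟩ := h ε hε
  refine ⟨δ, hδ, ?_⟩
  rintro ⟨n, I⟩ ⟨hI1, hI2⟩ hlt
  refine H (n, fun i => (-(I i).1, -(I i).2)) ⟨fun i hi => ?_, fun i hi j hj hij => ?_⟩ ?_
  · have := hI1 i hi
    simp only [uIcc, mem_Icc] at this ⊢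
    grind
  · have := hI2 hi hj hij
    simp only [Function.onFun, uIoc, Set.Ioc_disjoint_Ioc] at this ⊢
    grind
  · simpa [dist_neg_neg] using hlt

lemma ac_congr {f g : ℝ → ℝ} {a b : ℝ} (hab : a ≤ b) (hfg : EqOn f g (Icc a b))
    (h : AbsolutelyContinuousOnInterval f a b) : AbsolutelyContinuousOnInterval g a b := by
  rw [absolutelyContinuousOnInterval_iff] at *
  intro ε hε
  obtain ⟨δ, hδ, H⟩ := h ε hε
  refine ⟨δ, hδ, fun E hE hlt => ?_⟩
  have := H E hE hlt
  refine lt_of_le_of_lt (le_of_eq (Finset.sum_congr rfl fun i hi => ?_)) this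
  have h1 := (hE.1 i hi).1
  have h2 := (hE.1 i hi).2
  rw [uIcc_of_le hab] at h1 h2
  rw [hfg h1, hfg h2]

lemma IsACPath.congr {γ σ : ℝ → Z} {a b : ℝ} (hab : a ≤ b) (h : IsACPath γ a b)
    (hs : EqOn γ σ (Icc a b)) : IsACPath σ a b := by
  refine ⟨h.1.congr hs.symm, ?_, ac_congr hab (fun t ht => ?_) h.2.2⟩
  · rw [← eVariationOn.congr hs]; exact h.2.1
  · exact congrArg ENNReal.toReal (eVariationOn.congr (hs.mono (Icc_subset_Icc_right ht.2)))

lemma IsACPath.const (z : Z) {a b : ℝ} : IsACPath (fun _ => z) a b := by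
  have h0 : ∀ s : Set ℝ, eVariationOn (fun _ : ℝ => z) s = 0 := fun s =>
    eVariationOn.constant_on (f := fun _ : ℝ => z) (by
      rintro _ ⟨x, _, rfl⟩ _ ⟨y, _, rfl⟩; rfl)
  refine ⟨continuousOn_const, by rw [h0]; exact ENNReal.zero_ne_top, ?_⟩
  simp only [h0]
  exact ac_const _ a b

lemma IsACPath.glue {γ : ℝ → Z} {a b c : ℝ} (hab : a ≤ b) (hbc : b ≤ c)
    (h1 : IsACPath γ a b) (h2 : IsACPath γ b c) : IsACPath γ a c := by
  have hadd : ∀ t, b ≤ t → eVariationOn γ (Icc a t) =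
      eVariationOn γ (Icc a b) + eVariationOn γ (Icc b t) := fun t ht => by
    have := eVariationOn.Icc_add_Icc γ (s := univ) hab ht (mem_univ b)
    simpa using this.symm
  refine ⟨?_, ?_, ?_⟩
  · rw [← Icc_union_Icc_eq_Icc hab hbc]
    exact h1.1.union_of_isClosed h2.1 isClosed_Icc isClosed_Icc
  · rw [hadd c hbc]
    exact ENNReal.add_ne_top.2 ⟨h1.2.1, h2.2.1⟩
  · refine ac_glue hab hbc h1.2.2 ?_
    have hc : AbsolutelyContinuousOnInterval
        (fun _ : ℝ => (eVariationOn γ (Icc a b)).toReal) b c :=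
      ac_const _ _ _
    refine ac_congr hbc (fun t ht => ?_) (hc.add h2.2.2)
    simp only [Pi.add_apply]
    rw [hadd t ht.1, ENNReal.toReal_add h1.2.1]
    exact ne_top_of_le_ne_top h2.2.1 (eVariationOn.mono _ (Icc_subset_Icc_right ht.2))

lemma IsACPath.shift {γ : ℝ → Z} {a b : ℝ} (s : ℝ) (h : IsACPath γ a b) :
    IsACPath (fun t => γ (t + s)) (a - s) (b - s) := by
  have hv : ∀ t, eVariationOn (fun t => γ (t + s)) (Icc (a - s) t) =
      eVariationOn γ (Icc a (t + s)) := fun t => by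
    have := eVariationOn.comp_eq_of_monotoneOn γ (t := Icc (a - s) t) (fun t => t + s)
      (fun x _ y _ hxy => by simpa using hxy)
    rw [image_add_const_Icc, sub_add_cancel] at this
    exact this
  refine ⟨?_, ?_, ?_⟩
  · refine h.1.comp (f := fun t : ℝ => t + s) (s := Icc (a - s) (b - s))
      (continuous_add_const s).continuousOn (fun t ht => ?_)
    simp only [mem_Icc] at ht ⊢
    constructor <;> linarith [ht.1, ht.2]
  · rw [hv, sub_add_cancel]; exact h.2.1
  · simp only [hv]
    exact ac_shift (f := fun t => (eVariationOn γ (Icc a t)).toReal) s h.2.2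

lemma IsACPath.reverse {γ : ℝ → Z} {a b : ℝ} (hab : a ≤ b) (h : IsACPath γ a b) :
    IsACPath (fun t => γ (-t)) (-b) (-a) := by
  have hv : ∀ t, eVariationOn (fun t => γ (-t)) (Icc (-b) t) =
      eVariationOn γ (Icc (-t) b) := fun t => by
    have := eVariationOn.comp_eq_of_antitoneOn γ (t := Icc (-b) t) (fun t => -t)
      (fun x _ y _ hxy => by simpa using hxy)
    rw [Set.image_neg_eq_neg, Set.neg_Icc, neg_neg] at this
    exact this
  refine ⟨?_, ?_, ?_⟩
  · refine h.1.comp (f := fun t : ℝ => -t) (s := Icc (-b) (-a))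
      continuous_neg.continuousOn (fun t ht => ?_)
    simp only [mem_Icc] at ht ⊢
    constructor <;> linarith [ht.1, ht.2]
  · rw [hv, neg_neg]; exact h.2.1
  · have hc : AbsolutelyContinuousOnInterval
        (fun _ : ℝ => (eVariationOn γ (Icc a b)).toReal) (-b) (-a) :=
      ac_const _ _ _
    refine ac_congr (by linarith) (fun t ht => ?_) 
      (hc.sub (ac_neg (f := fun t => (eVariationOn γ (Icc a t)).toReal) h.2.2))
    simp only [Pi.sub_apply, hv]
    have h1 : a ≤ -t := by linarith [ht.2]
    have h2 : -t ≤ b := by linarith [ht.1]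
    have := eVariationOn.Icc_add_Icc γ (s := univ) h1 h2 (mem_univ _)
    simp only [univ_inter] at this
    rw [← this, ENNReal.toReal_add, add_sub_cancel_left]
    · exact ne_top_of_le_ne_top h.2.1 (eVariationOn.mono _ (Icc_subset_Icc_right h2))
    · exact ne_top_of_le_ne_top h.2.1 (eVariationOn.mono _ (Icc_subset_Icc_left h1))

lemma metricSpeed_congr {γ σ : ℝ → Z} {t : ℝ} (h : γ =ᶠ[𝓝 t] σ) :
    metricSpeed γ t = metricSpeed σ t := by
  refine limsup_congr ?_
  filter_upwards [h.filter_mono nhdsWithin_le_nhds] with s hs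
  rw [hs, h.eq_of_nhds]

lemma metricSpeed_const (z : Z) (t : ℝ) : metricSpeed (fun _ : ℝ => z) t = 0 := by
  simp [metricSpeed]

lemma metricSpeed_comp {γ : ℝ → Z} (e : ℝ ≃ᵢ ℝ) (t : ℝ) :
    metricSpeed (fun t => γ (e t)) t = metricSpeed γ (e t) := by
  have hmap : map e (𝓝[≠] t) = 𝓝[≠] (e t) := by
    have := e.toHomeomorph.isEmbedding.map_nhdsWithin_eq {t}ᶜ t
    rw [image_compl_eq e.toHomeomorph.bijective, image_singleton] at this
    exact this
  unfold metricSpeed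
  rw [← hmap, limsup, limsup, map_map]
  congr 2
  funext s
  simp [e.edist_eq]

end PathFacts

/-! ### The warped product -/

section Warped

variable {X Y : Type*} [PseudoEMetricSpace X] [PseudoEMetricSpace Y]

/-- The warped speed `‖(|γ_X'(t)|, φ(γ_X(t)) |γ_Y'(t)|)‖`. -/
noncomputable def warpedSpeed (φ : X → ℝ≥0) (N : Seminorm ℝ (ℝ × ℝ)) (γ : ℝ → X × Y) (t : ℝ) : ℝ :=
  N ((metricSpeed (fun s => (γ s).1) t).toReal,
    φ (γ t).1 * (metricSpeed (fun s => (γ s).2) t).toReal)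

/-- The warped length `ℓ_φ(γ) = ∫_a^b ‖(|γ_X'(t)|, φ(γ_X(t)) |γ_Y'(t)|)‖ dt`. -/
noncomputable def warpedLength (φ : X → ℝ≥0) (N : Seminorm ℝ (ℝ × ℝ)) (γ : ℝ → X × Y) (a b : ℝ) :
    ℝ≥0∞ :=
  ∫⁻ t in Ioo a b, ENNReal.ofReal (warpedSpeed φ N γ t)

/-- `γ` restricted to `[a, b]` is an absolutely continuous path in `X × Y` from `p` to `q`:
both coordinates are absolutely continuous. -/
def Joins (γ : ℝ → X × Y) (a b : ℝ) (p q : X × Y) : Prop :=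
  a < b ∧ IsACPath (fun t => (γ t).1) a b ∧ IsACPath (fun t => (γ t).2) a b ∧ γ a = p ∧ γ b = q

/-- The warped distance `d_φ(p, q) = inf_γ ℓ_φ(γ)` on `X × Y`, the infimum over all absolutely
continuous paths from `p` to `q`. -/
noncomputable def warpedEDist (φ : X → ℝ≥0) (N : Seminorm ℝ (ℝ × ℝ)) (p q : X × Y) : ℝ≥0∞ :=
  sInf {L | ∃ (γ : ℝ → X × Y) (a b : ℝ), Joins γ a b p q ∧ L = warpedLength φ N γ a b}

variable {φ : X → ℝ≥0} {N : Seminorm ℝ (ℝ × ℝ)}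

lemma warpedSpeed_congr {γ σ : ℝ → X × Y} {t : ℝ} (h : γ =ᶠ[𝓝 t] σ) :
    warpedSpeed φ N γ t = warpedSpeed φ N σ t := by
  unfold warpedSpeed
  rw [metricSpeed_congr (σ := fun s => (σ s).1) (h.mono fun s hs => by simp only [hs]),
    metricSpeed_congr (σ := fun s => (σ s).2) (h.mono fun s hs => by simp only [hs]),
    h.eq_of_nhds]

lemma warpedSpeed_comp {γ : ℝ → X × Y} (e : ℝ ≃ᵢ ℝ) (t : ℝ) :
    warpedSpeed φ N (fun t => γ (e t)) t = warpedSpeed φ N γ (e t) := by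
  unfold warpedSpeed
  rw [metricSpeed_comp (γ := fun s => (γ s).1) e, metricSpeed_comp (γ := fun s => (γ s).2) e]

lemma warpedLength_congr {γ σ : ℝ → X × Y} {a b : ℝ} (h : EqOn γ σ (Icc a b)) :
    warpedLength φ N γ a b = warpedLength φ N σ a b := by
  refine setLIntegral_congr_fun measurableSet_Ioo fun t ht => ?_
  refine congrArg ENNReal.ofReal (warpedSpeed_congr ?_)
  filter_upwards [Ioo_mem_nhds ht.1 ht.2] with s hs using h (Ioo_subset_Icc_self hs)

lemma warpedLength_comp {γ : ℝ → X × Y} {a b a' b' : ℝ} (e : ℝ ≃ᵢ ℝ)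
    (he : MeasurePreserving e volume volume) (hpre : e ⁻¹' Ioo a b = Ioo a' b') :
    warpedLength φ N (fun t => γ (e t)) a' b' = warpedLength φ N γ a b := by
  unfold warpedLength
  simp only [warpedSpeed_comp]
  rw [← hpre]
  exact he.setLIntegral_comp_preimage_emb e.toHomeomorph.measurableEmbedding
    (fun t => ENNReal.ofReal (warpedSpeed φ N γ t)) (Ioo a b)

lemma warpedLength_glue {γ : ℝ → X × Y} {a b c : ℝ} (hab : a < b) (hbc : b < c) :
    warpedLength φ N γ a c ≤ warpedLength φ N γ a b + warpedLength φ N γ b c := by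
  unfold warpedLength
  rw [← Ioc_union_Ioo_eq_Ioo hab.le hbc]
  refine (lintegral_union_le _ _ _).trans (le_of_eq ?_)
  rw [setLIntegral_congr (Ioo_ae_eq_Ioc (a := a) (b := b))]

lemma warpedEDist_self (p : X × Y) : warpedEDist φ N p p = 0 := by
  refine le_antisymm (sInf_le ⟨fun _ => p, 0, 1, ⟨one_pos, .const _, .const _, rfl, rfl⟩, ?_⟩)
    zero_le
  simp [warpedLength, warpedSpeed, metricSpeed_const, ← Prod.zero_eq_mk]

lemma warpedEDist_comm_le (p q : X × Y) : warpedEDist φ N q p ≤ warpedEDist φ N p q := by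
  refine le_sInf ?_
  rintro L ⟨γ, a, b, ⟨hab, h1, h2, ha, hb⟩, rfl⟩
  refine sInf_le ⟨fun t => γ (-t), -b, -a, ⟨neg_lt_neg hab, h1.reverse hab.le, h2.reverse hab.le,
    by simpa using hb, by simpa using ha⟩, ?_⟩
  exact (warpedLength_comp (IsometryEquiv.neg ℝ) (Measure.measurePreserving_neg volume)
    (by ext t; simp only [mem_preimage, IsometryEquiv.neg_apply, mem_Ioo]; grind)).symm

lemma warpedEDist_triangle (p q r : X × Y) :
    warpedEDist φ N p r ≤ warpedEDist φ N p q + warpedEDist φ N q r := by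
  unfold warpedEDist
  rw [ENNReal.sInf_add]
  refine le_iInf₂ fun L hL => ?_
  rw [add_comm, ENNReal.sInf_add]
  refine le_iInf₂ fun L' hL' => ?_
  obtain ⟨γ, a, b, ⟨hab, h1, h2, ha, hb⟩, rfl⟩ := hL
  obtain ⟨σ, c, d, ⟨hcd, k1, k2, hc, hd⟩, rfl⟩ := hL'
  have hbd : b < d - (c - b) := by linarith
  have hcb : c - (c - b) = b := by ring
  let τ : ℝ → X × Y := fun t => if t ≤ b then γ t else σ (t + (c - b))
  have e1 : EqOn γ τ (Icc a b) := fun t ht => by simp [τ, ht.2]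
  have e2 : EqOn (fun t => σ (t + (c - b))) τ (Icc b (d - (c - b))) := fun t ht => by
    by_cases h : t ≤ b
    · obtain rfl : t = b := le_antisymm h ht.1
      simp [τ, hb, hc]
    · simp [τ, h]
  have k1' := k1.shift (c - b)
  have k2' := k2.shift (c - b)
  rw [hcb] at k1' k2'
  refine le_trans (sInf_le ⟨τ, a, d - (c - b), ⟨hab.trans hbd, ?_, ?_, ?_, ?_⟩, rfl⟩) ?_
  · exact (h1.congr hab.le fun t ht => congrArg Prod.fst (e1 ht)).glue hab.le hbd.le
      (k1'.congr hbd.le fun t ht => congrArg Prod.fst (e2 ht))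
  · exact (h2.congr hab.le fun t ht => congrArg Prod.snd (e1 ht)).glue hab.le hbd.le
      (k2'.congr hbd.le fun t ht => congrArg Prod.snd (e2 ht))
  · rw [← e1 (left_mem_Icc.2 hab.le), ha]
  · rw [← e2 (right_mem_Icc.2 hbd.le)]; simp [hd]
  · refine (warpedLength_glue hab hbd).trans (le_of_eq ?_)
    rw [← warpedLength_congr e1, ← warpedLength_congr e2, add_comm]
    congr 1
    exact warpedLength_comp (IsometryEquiv.addRight (c - b))
      (measurePreserving_add_right volume (c - b))
      (by ext t; simp only [mem_preimage, IsometryEquiv.addRight_apply, mem_Ioo]; grind)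

/-- The set `X × Y`, to be equipped with the warped pseudodistance `d_φ`. -/
def WarpedPre (X Y : Type*) (_φ : X → ℝ≥0) (_N : Seminorm ℝ (ℝ × ℝ)) : Type _ := X × Y

noncomputable instance : PseudoEMetricSpace (WarpedPre X Y φ N) where
  edist := fun p q : X × Y => warpedEDist φ N p q
  edist_self := fun p : X × Y => warpedEDist_self p
  edist_comm := fun p q : X × Y => le_antisymm (warpedEDist_comm_le q p) (warpedEDist_comm_le p q)
  edist_triangle := fun p q r : X × Y => warpedEDist_triangle p q r

/-- The warped product `X ×_φ Y`: the quotient of `X × Y` by the relation `d_φ(p, q) = 0`, with the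
distance induced by `d_φ`. -/
def WarpedProduct (X Y : Type*) [PseudoEMetricSpace X] [PseudoEMetricSpace Y] (φ : X → ℝ≥0)
    (N : Seminorm ℝ (ℝ × ℝ)) : Type _ := SeparationQuotient (WarpedPre X Y φ N)

noncomputable instance : EMetricSpace (WarpedProduct X Y φ N) :=
  inferInstanceAs (EMetricSpace (SeparationQuotient (WarpedPre X Y φ N)))

noncomputable instance : MeasurableSpace (WarpedProduct X Y φ N) := borel _

instance : BorelSpace (WarpedProduct X Y φ N) := ⟨rfl⟩

/-- The projection `P_φ : X × Y → X ×_φ Y`. -/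
noncomputable def warpedProj (φ : X → ℝ≥0) (N : Seminorm ℝ (ℝ × ℝ)) (p : X × Y) : WarpedProduct X Y φ N :=
  SeparationQuotient.mk (X := WarpedPre X Y φ N) p

/-- The measure `μ_φ` on `X ×_φ Y`, the push-forward of `μ_X × μ_Y` under `P_φ`. -/
noncomputable def warpedMeasure [MeasurableSpace X] [MeasurableSpace Y] (φ : X → ℝ≥0)
    (N : Seminorm ℝ (ℝ × ℝ)) (μX : Measure X) (μY : Measure Y) : Measure (WarpedProduct X Y φ N) :=
  (μX.prod μY).map (warpedProj φ N)

lemma edist_warpedProj (p q : X × Y) :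
    edist (warpedProj φ N p) (warpedProj φ N q) = warpedEDist φ N p q :=
  SeparationQuotient.edist_mk (X := WarpedPre X Y φ N) p q

end Warped

end WarpedPI

/-! Fix a Dirichlet function `u` on the warped product and a `p`-integrable upper gradient `g`. A
slice `x ↦ (x, y)` is `1`-Lipschitz, so `g` restricts to an upper gradient on it. For a.e. `y`, the
Sobolev–Poincaré inequality of `X` therefore gives a constant `c y` with `∫ |u(x, y) - c y|^p dx ≤
C_X^p ∫ g(x, y)^p dx`. If `c` equals one number `k` a.e., integrating over `y` gives the claim with
the same `C_X`. Only the constancy of `c` needs an argument.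

A slice `y ↦ (x, y)` is `φ x`-Lipschitz, so `φ x * g` is an upper gradient on it where `φ x > 0`.
Let `B` be a ball of the local Poincaré inequality of `Y`, with constant `C`, and let `m x` be the
mean of `u(x, ·)` over `B`. Then `φ(x)^{-p} ∫_B |u(x, y) - m x|^p dy ≤ C^p ∫ g(x, y)^p dy`, and the
right side is integrable in `x`. Hence, for a.e. `y ∈ B`, the functions `u(·, y)` and `m` differ by
a function in `L^p(E, φ^{-p} dμ_X)`. The weight is bounded on `E`, so `u(·, y) - c y` lies there
too, and so does `m - c y`. Two values of `c` would then differ by a constant in this `L^p` space,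
which is zero because the weight has infinite mass on `E` (`ae_const_of_weight`,
`ae_const_on_eball`). Thus `c` is locally a.e. constant, and a.e. constant since `Y` is connected
(`ae_const_of_locally_ae_const`).

The slice restrictions are `IsUpperGradient.horizontal` and `IsUpperGradient.vertical`. They rest on
the distance estimates `warpedEDist_horizontal_le` and `warpedEDist_vertical_le`. The decomposition
of the Dirichlet class follows by subtracting `k` (`IsSobolevPoincare.dirichletSobolev_eq`). -/

namespace WarpedPI

/-! ### Absolutely continuous paths: Lipschitz images and metric speed -/

section PathTools

/-- Domination of increments transfers absolute continuity. In the applications `g` is the length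
function of a path, whose increments are computed for ordered pairs only. -/
lemma ac_of_dist_le {f g : ℝ → ℝ} {a b : ℝ} (hab : a ≤ b) (K : ℝ≥0)
    (hg : AbsolutelyContinuousOnInterval g a b)
    (h : ∀ s ∈ Icc a b, ∀ t ∈ Icc a b, s ≤ t → dist (f s) (f t) ≤ K * dist (g s) (g t)) :
    AbsolutelyContinuousOnInterval f a b := by
  have h' : ∀ s ∈ Icc a b, ∀ t ∈ Icc a b, dist (f s) (f t) ≤ K * dist (g s) (g t) := by
    intro s hs t ht
    rcases le_total s t with hst | hst
    · exact h s hs t ht hst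
    · rw [dist_comm (f s), dist_comm (g s)]; exact h t ht s hs hst
  rw [absolutelyContinuousOnInterval_iff] at *
  intro ε hε
  -- `K + 1` instead of `K`, since `K` may be zero.
  obtain ⟨δ, hδ, H⟩ := hg (ε / (K + 1)) (by positivity)
  refine ⟨δ, hδ, fun E hE hlt => ?_⟩
  have hK : (0 : ℝ) < K + 1 := by positivity
  have h1 := H E hE hlt
  rw [lt_div_iff₀ hK] at h1
  refine lt_of_le_of_lt ?_ h1
  rw [Finset.sum_mul]
  refine Finset.sum_le_sum fun i hi => ?_
  have e1 := (hE.1 i hi).1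
  have e2 := (hE.1 i hi).2
  rw [uIcc_of_le hab] at e1 e2
  refine (h' _ e1 _ e2).trans ?_
  rw [mul_comm]
  gcongr
  linarith

variable {Z W : Type*} [PseudoEMetricSpace Z] [PseudoEMetricSpace W]

lemma IsACPath.mono {γ : ℝ → Z} {a b c : ℝ} (h : IsACPath γ a b) (hac : a ≤ c) (hcb : c ≤ b) :
    IsACPath γ a c :=
  ⟨h.1.mono (Icc_subset_Icc_right hcb),
    ne_top_of_le_ne_top h.2.1 (eVariationOn.mono _ (Icc_subset_Icc_right hcb)),
    h.2.2.mono (by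
      rw [uIcc_of_le hac, uIcc_of_le (hac.trans hcb)]; exact Icc_subset_Icc_right hcb)⟩

lemma IsACPath.variation_sub {γ : ℝ → Z} {a b s t : ℝ} (h : IsACPath γ a b) (hs : a ≤ s)
    (hst : s ≤ t) (ht : t ≤ b) :
    (eVariationOn γ (Icc a t)).toReal - (eVariationOn γ (Icc a s)).toReal =
      (eVariationOn γ (Icc s t)).toReal ∧ eVariationOn γ (Icc s t) ≠ ∞ := by
  have h1 := eVariationOn.Icc_add_Icc γ (s := univ) hs hst (mem_univ _)
  simp only [univ_inter] at h1
  have f1 : eVariationOn γ (Icc a s) ≠ ∞ :=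
    ne_top_of_le_ne_top h.2.1 (eVariationOn.mono _ (Icc_subset_Icc_right (hst.trans ht)))
  have f2 : eVariationOn γ (Icc s t) ≠ ∞ :=
    ne_top_of_le_ne_top h.2.1 (eVariationOn.mono _ (Icc_subset_Icc hs ht))
  refine ⟨?_, f2⟩
  rw [← h1, ENNReal.toReal_add f1 f2]
  ring

/-- On every subinterval the length of the image is at most `K` times the length of `γ`, so the new
length function is dominated by the old one. Through this, slices carry test paths to test paths for
upper gradients. -/
lemma IsACPath.comp_lipschitz {γ : ℝ → Z} {a b : ℝ} (hab : a ≤ b) (h : IsACPath γ a b)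
    {f : Z → W} {K : ℝ≥0} (hf : LipschitzWith K f) : IsACPath (fun t => f (γ t)) a b := by
  have hv : ∀ s : Set ℝ, eVariationOn (fun t => f (γ t)) s ≤ K * eVariationOn γ s := fun s =>
    (hf.lipschitzOnWith (s := univ)).comp_eVariationOn_le (f := f) (g := γ) (fun _ _ => mem_univ _)
  have hfin : eVariationOn (fun t => f (γ t)) (Icc a b) ≠ ∞ :=
    ne_top_of_le_ne_top (ENNReal.mul_ne_top ENNReal.coe_ne_top h.2.1) (hv _)
  refine ⟨hf.continuous.comp_continuousOn h.1, hfin, ac_of_dist_le hab K h.2.2 ?_⟩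
  intro s hs t ht hst
  obtain ⟨e1, e2⟩ := h.variation_sub hs.1 hst ht.2
  have h1 := eVariationOn.Icc_add_Icc (fun t => f (γ t)) (s := univ) hs.1 hst (mem_univ _)
  simp only [univ_inter] at h1
  have f1 : eVariationOn (fun t => f (γ t)) (Icc a s) ≠ ∞ :=
    ne_top_of_le_ne_top hfin (eVariationOn.mono _ (Icc_subset_Icc_right hs.2))
  have f2 : eVariationOn (fun t => f (γ t)) (Icc s t) ≠ ∞ :=
    ne_top_of_le_ne_top hfin (eVariationOn.mono _ (Icc_subset_Icc hs.1 ht.2))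
  rw [dist_comm, dist_comm (eVariationOn γ (Icc a s)).toReal, Real.dist_eq, Real.dist_eq, e1, ← h1,
    ENNReal.toReal_add f1 f2, add_sub_cancel_left, abs_of_nonneg ENNReal.toReal_nonneg,
    abs_of_nonneg ENNReal.toReal_nonneg]
  have := ENNReal.toReal_mono (ENNReal.mul_ne_top ENNReal.coe_ne_top e2) (hv (Icc s t))
  simpa using this

lemma metricSpeed_comp_le {γ : ℝ → Z} {f : Z → W} {K : ℝ≥0}
    (hf : ∀ x y, edist (f x) (f y) ≤ K * edist x y) (t : ℝ) :
    metricSpeed (fun t => f (γ t)) t ≤ K * metricSpeed γ t := by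
  unfold metricSpeed
  rw [← ENNReal.limsup_const_mul_of_ne_top ENNReal.coe_ne_top]
  refine limsup_le_limsup (Eventually.of_forall fun s => ?_)
  simp only [← mul_div_assoc]
  exact ENNReal.div_le_div_right (hf _ _) _

lemma metricSpeed_le_of_lipschitzOn {γ : ℝ → Z} {K : ℝ≥0} {s : Set ℝ} (hf : LipschitzOnWith K γ s)
    {t : ℝ} (ht : s ∈ 𝓝 t) : metricSpeed γ t ≤ K := by
  refine limsup_le_of_le (by isBoundedDefault) ?_
  filter_upwards [nhdsWithin_le_nhds ht] with r hr
  exact ENNReal.div_le_of_le_mul (hf hr (mem_of_mem_nhds ht))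

/-- A function bounded by the increments of `γ` has derivative bounded by the metric speed. -/
lemma enorm_deriv_le_metricSpeed {γ : ℝ → Z} {f : ℝ → ℝ} {t f' : ℝ} (hd : HasDerivAt f f' t)
    (h : ∀ᶠ s in 𝓝 t, edist (f s) (f t) ≤ edist (γ s) (γ t)) : ‖f'‖ₑ ≤ metricSpeed γ t := by
  have h1 : Tendsto (fun s => ‖slope f t s‖ₑ) (𝓝[≠] t) (𝓝 ‖f'‖ₑ) :=
    (hasDerivAt_iff_tendsto_slope.1 hd).enorm
  rw [← h1.limsup_eq]
  refine limsup_le_limsup ?_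
  filter_upwards [nhdsWithin_le_nhds h, self_mem_nhdsWithin] with s hs hst
  rw [slope_def_module, enorm_smul, enorm_inv (sub_ne_zero.2 hst), mul_comm, ← div_eq_mul_inv,
    ← edist_eq_enorm_sub, ← edist_eq_enorm_sub]
  exact ENNReal.div_le_div_right hs _

/-- The speed is bounded by the derivative of the length function wherever that exists. Finiteness
matters because `warpedSpeed` applies `toReal`, which turns an infinite speed into zero. -/
lemma IsACPath.ae_metricSpeed_lt_top {γ : ℝ → Z} {a b : ℝ} (hab : a ≤ b) (h : IsACPath γ a b) :
    ∀ᵐ t, t ∈ Ioo a b → metricSpeed γ t < ∞ := by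
  filter_upwards [h.2.2.ae_differentiableAt] with t ht hmem
  rw [uIcc_of_le hab] at ht
  have hd := (ht (Ioo_subset_Icc_self hmem)).hasDerivAt
  set V : ℝ → ℝ := fun t => (eVariationOn γ (Icc a t)).toReal
  have h1 : Tendsto (fun s => ‖slope V t s‖ₑ) (𝓝[≠] t) (𝓝 ‖deriv V t‖ₑ) :=
    (hasDerivAt_iff_tendsto_slope.1 hd).enorm
  refine lt_of_le_of_lt ?_ (enorm_lt_top (x := deriv V t))
  rw [← h1.limsup_eq]
  refine limsup_le_limsup ?_
  have key : ∀ s ∈ Icc a b, ∀ t ∈ Icc a b, s ≤ t → edist (γ s) (γ t) ≤ edist (V s) (V t) := by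
    intro s hs t ht hst
    obtain ⟨e1, e2⟩ := h.variation_sub hs.1 hst ht.2
    rw [edist_comm (V s), edist_dist, Real.dist_eq, e1, abs_of_nonneg ENNReal.toReal_nonneg,
      ENNReal.ofReal_toReal e2]
    exact eVariationOn.edist_le _ (left_mem_Icc.2 hst) (right_mem_Icc.2 hst)
  filter_upwards [nhdsWithin_le_nhds (Ioo_mem_nhds hmem.1 hmem.2), self_mem_nhdsWithin]
    with s hs hst
  rw [slope_def_module, enorm_smul, enorm_inv (sub_ne_zero.2 hst), mul_comm, ← div_eq_mul_inv,
    ← edist_eq_enorm_sub, ← edist_eq_enorm_sub]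
  refine ENNReal.div_le_div_right ?_ _
  have hs' := Ioo_subset_Icc_self hs
  have ht' := Ioo_subset_Icc_self hmem
  rcases le_total s t with hle | hle
  · exact key s hs' t ht' hle
  · rw [edist_comm, edist_comm (V s)]; exact key t ht' s hs' hle

/-- The distance of the end points is at most the integral of the metric speed. -/
lemma IsACPath.edist_le {γ : ℝ → Z} {a b : ℝ} (hab : a ≤ b) (h : IsACPath γ a b) :
    edist (γ a) (γ b) ≤ ∫⁻ t in Ioo a b, metricSpeed γ t := by
  have hfin : ∀ s ∈ Icc a b, ∀ t ∈ Icc a b, edist (γ s) (γ t) ≠ ∞ := fun s hs t ht =>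
    ne_top_of_le_ne_top h.2.1 (eVariationOn.edist_le _ hs ht)
  have ha : a ∈ Icc a b := left_mem_Icc.2 hab
  -- The distance to the starting point reduces the claim to the fundamental theorem of calculus for
  -- a real function: its increments are bounded by those of `γ`.
  set f : ℝ → ℝ := fun t => (edist (γ a) (γ t)).toReal with hfdef
  have hinc : ∀ s ∈ Icc a b, ∀ t ∈ Icc a b, edist (f s) (f t) ≤ edist (γ s) (γ t) := by
    have aux : ∀ s ∈ Icc a b, ∀ t ∈ Icc a b, f s - f t ≤ (edist (γ s) (γ t)).toReal := by
      intro s hs t ht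
      have : edist (γ a) (γ s) ≤ edist (γ a) (γ t) + edist (γ s) (γ t) := by
        rw [edist_comm (γ s)]; exact edist_triangle _ _ _
      have := ENNReal.toReal_mono
        (ENNReal.add_ne_top.2 ⟨hfin a ha t ht, hfin s hs t ht⟩) this
      rw [ENNReal.toReal_add (hfin a ha t ht) (hfin s hs t ht)] at this
      simp only [hfdef]
      linarith
    intro s hs t ht
    rw [edist_dist, Real.dist_eq]
    refine ENNReal.ofReal_le_of_le_toReal (abs_le.2 ⟨?_, aux s hs t ht⟩)
    have := aux t ht s hs
    rw [edist_comm] at this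
    linarith
  have hac : AbsolutelyContinuousOnInterval f a b := by
    refine ac_of_dist_le hab 1 h.2.2 fun s hs t ht hst => ?_
    obtain ⟨e1, e2⟩ := h.variation_sub hs.1 hst ht.2
    rw [dist_comm (eVariationOn γ (Icc a s)).toReal, Real.dist_eq (eVariationOn γ (Icc a t)).toReal,
      e1,
      abs_of_nonneg ENNReal.toReal_nonneg, NNReal.coe_one, one_mul, dist_edist]
    exact ENNReal.toReal_mono e2 ((hinc s hs t ht).trans
      (eVariationOn.edist_le _ (left_mem_Icc.2 hst) (right_mem_Icc.2 hst)))
  have hFTC := hac.integral_deriv_eq_sub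
  have hfa : f a = 0 := by simp [hfdef]
  have hb : edist (γ a) (γ b) = ‖f b‖ₑ := by
    rw [Real.enorm_eq_ofReal ENNReal.toReal_nonneg,
      ENNReal.ofReal_toReal (hfin a ha b (right_mem_Icc.2 hab))]
  rw [hfa, sub_zero] at hFTC
  rw [hb, ← hFTC, intervalIntegral.integral_of_le hab]
  refine (enorm_integral_le_lintegral_enorm _).trans ?_
  rw [← setLIntegral_congr Ioo_ae_eq_Ioc]
  refine lintegral_mono_ae ((ae_restrict_iff' measurableSet_Ioo).2 ?_)
  filter_upwards [hac.ae_differentiableAt] with t ht hmem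
  rw [uIcc_of_le hab] at ht
  refine enorm_deriv_le_metricSpeed (ht (Ioo_subset_Icc_self hmem)).hasDerivAt ?_
  filter_upwards [Ioo_mem_nhds hmem.1 hmem.2] with s hs
  exact hinc s (Ioo_subset_Icc_self hs) t (Ioo_subset_Icc_self hmem)

end PathTools

/-! ### Arc-length parametrization in length spaces -/

section LengthSpaces

variable {Z : Type*} [MetricSpace Z]

/-- The variation function can jump only where `f` jumps. Continuity makes arc length attain every
intermediate value, so that the natural parameterization is controlled on a whole interval. -/
lemma continuous_variationOnFromTo {f : unitInterval → Z} (hf : Continuous f)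
    (hv : LocallyBoundedVariationOn f univ) (a : unitInterval) :
    Continuous (variationOnFromTo f univ a) := by
  refine continuous_iff_continuousAt.2 fun b => continuousAt_iff_continuous_left'_right'.2 ⟨?_, ?_⟩
  · have := variationOnFromTo.tendsto_left (mem_univ a) (mem_univ b) hv
      (l := f b) hf.continuousWithinAt
    simpa [ContinuousWithinAt] using this
  · have := variationOnFromTo.tendsto_right (mem_univ a) (mem_univ b) hv
      (l := f b) hf.continuousWithinAt
    simpa [ContinuousWithinAt] using this

/-- In a length space, points at finite distance are joined by `1`-Lipschitz paths defined on
intervals of almost optimal length. -/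
lemma IsLengthSpace.exists_path (hZ : IsLengthSpace Z) {x y : Z} {r : ℝ≥0∞} (hr : edist x y < r) :
    ∃ (γ : ℝ → Z) (l : ℝ), 0 ≤ l ∧ ENNReal.ofReal l < r ∧ γ 0 = x ∧ γ l = y ∧
      IsACPath γ 0 l ∧ LipschitzOnWith 1 γ (Icc 0 l) := by
  rw [hZ x y, iInf_lt_iff] at hr
  obtain ⟨σ, hσ⟩ := hr
  have hσfin : eVariationOn σ univ ≠ ∞ := hσ.ne_top
  have hbv : LocallyBoundedVariationOn σ univ := BoundedVariationOn.locallyBoundedVariationOn hσfin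
  set v := variationOnFromTo σ univ (0 : unitInterval) with hv
  have hv0 : v 0 = 0 := variationOnFromTo.self _ _ _
  have hv1 : ENNReal.ofReal (v 1) = eVariationOn σ univ := by
    have : univ ∩ Icc (0 : unitInterval) 1 = univ := by
      rw [univ_inter]; exact Set.eq_univ_of_forall fun t => ⟨t.2.1, t.2.2⟩
    rw [hv, variationOnFromTo.eq_of_le _ _ zero_le_one, this, ENNReal.ofReal_toReal hσfin]
  have hl : 0 ≤ v 1 := variationOnFromTo.nonneg_of_le _ _ zero_le_one
  have himage : Icc 0 (v 1) ⊆ v '' univ := by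
    have := intermediate_value_univ (0 : unitInterval) 1
      (continuous_variationOnFromTo σ.continuous hbv 0)
    rw [image_univ, ← hv0]
    exact this
  set γ := naturalParameterization σ univ (0 : unitInterval) with hγ
  have hunit : HasUnitSpeedOn γ (v '' univ) :=
    has_unit_speed_naturalParameterization _ hbv (mem_univ _)
  have hend : ∀ t, γ (v t) = σ t := fun t =>
    edist_eq_zero.1 (edist_naturalParameterization_eq_zero hbv (mem_univ _) (mem_univ t))
  have hvar : ∀ s ∈ Icc 0 (v 1), ∀ t ∈ Icc 0 (v 1),
      eVariationOn γ (Icc s t) = ENNReal.ofReal (t - s) := by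
    intro s hs t ht
    have := hunit (himage hs) (himage ht)
    rw [inter_eq_self_of_subset_right ((Icc_subset_Icc hs.1 ht.2).trans himage)] at this
    simpa using this
  have h0 : (0 : ℝ) ∈ Icc 0 (v 1) := left_mem_Icc.2 hl
  have hlip : LipschitzOnWith 1 γ (Icc 0 (v 1)) := by
    have aux : ∀ s ∈ Icc 0 (v 1), ∀ t ∈ Icc 0 (v 1), s ≤ t → edist (γ s) (γ t) ≤ edist s t := by
      intro s hs t ht hst
      refine (eVariationOn.edist_le _ (left_mem_Icc.2 hst) (right_mem_Icc.2 hst)).trans ?_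
      rw [hvar s hs t ht, edist_comm, edist_dist, Real.dist_eq, abs_of_nonneg (sub_nonneg.2 hst)]
    intro s hs t ht
    rw [ENNReal.coe_one, one_mul]
    rcases le_total s t with hst | hst
    · exact aux s hs t ht hst
    · rw [edist_comm, edist_comm s]; exact aux t ht s hs hst
  refine ⟨γ, v 1, hl, by rwa [hv1], ?_, ?_, ⟨hlip.continuousOn, ?_, ?_⟩, hlip⟩
  · rw [← hv0, hend]; exact σ.source
  · rw [hend]; exact σ.target
  · rw [hvar 0 h0 _ (right_mem_Icc.2 hl)]; exact ENNReal.ofReal_ne_top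
  · have hid : AbsolutelyContinuousOnInterval (fun t : ℝ => t) 0 (v 1) :=
      (LipschitzWith.id.lipschitzOnWith (s := uIcc 0 (v 1))).absolutelyContinuousOnInterval
    -- With unit speed, the length function is the identity on the parameter interval.
    refine ac_congr hl (fun t ht => ?_) hid
    simp [hvar 0 h0 t ht, ht.1]

end LengthSpaces

/-! ### Coordinate bounds for the product norm -/

section ProductNorm

variable {N : Seminorm ℝ (ℝ × ℝ)}

lemma IsProductNorm.apply_left (hN : IsProductNorm N) {a : ℝ} (ha : 0 ≤ a) : N (a, 0) = a := by
  have := map_smul_eq_mul N a (1, 0)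
  simpa [hN.unit_left, abs_of_nonneg ha] using this

lemma IsProductNorm.apply_right (hN : IsProductNorm N) {a : ℝ} (ha : 0 ≤ a) : N (0, a) = a := by
  have := map_smul_eq_mul N a (0, 1)
  simpa [hN.unit_right, abs_of_nonneg ha] using this

lemma IsProductNorm.left_le (hN : IsProductNorm N) {a b : ℝ} (ha : 0 ≤ a) (hb : 0 ≤ b) :
    a ≤ N (a, b) :=
  (hN.apply_left ha).symm.le.trans (hN.mono _ _ _ _ ha le_rfl le_rfl hb)

lemma IsProductNorm.right_le (hN : IsProductNorm N) {a b : ℝ} (ha : 0 ≤ a) (hb : 0 ≤ b) :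
    b ≤ N (a, b) :=
  (hN.apply_right hb).symm.le.trans (hN.mono _ _ _ _ le_rfl ha hb le_rfl)

end ProductNorm

/-! ### Estimates of the warped distance, and slices of upper gradients -/

section WarpedDistance

variable {X Y : Type*} [MetricSpace X] [MetricSpace Y] {φ : X → ℝ≥0} {N : Seminorm ℝ (ℝ × ℝ)}

lemma ac_edist_le_warpedLength_fst (hN : IsProductNorm N) {γ : ℝ → X × Y} {a b : ℝ} (hab : a ≤ b)
    (h : IsACPath (fun t => (γ t).1) a b) :
    edist (γ a).1 (γ b).1 ≤ warpedLength φ N γ a b := by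
  refine (h.edist_le hab).trans (lintegral_mono_ae ((ae_restrict_iff' measurableSet_Ioo).2 ?_))
  filter_upwards [h.ae_metricSpeed_lt_top hab] with t ht hmem
  rw [← ENNReal.ofReal_toReal (ht hmem).ne]
  exact ENNReal.ofReal_le_ofReal (hN.left_le ENNReal.toReal_nonneg (by positivity))

lemma ac_edist_le_warpedLength_snd (hN : IsProductNorm N) {γ : ℝ → X × Y} {a b : ℝ} (hab : a ≤ b)
    (h : IsACPath (fun t => (γ t).2) a b) {c : ℝ≥0} (hc : ∀ t ∈ Icc a b, c ≤ φ (γ t).1) :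
    c * edist (γ a).2 (γ b).2 ≤ warpedLength φ N γ a b := by
  refine (mul_le_mul_right (h.edist_le hab) _).trans ?_
  rw [← lintegral_const_mul' _ _ ENNReal.coe_ne_top]
  refine lintegral_mono_ae ((ae_restrict_iff' measurableSet_Ioo).2 ?_)
  filter_upwards [h.ae_metricSpeed_lt_top hab] with t ht hmem
  have h1 : (c : ℝ≥0∞) * metricSpeed (fun t => (γ t).2) t ≤
      φ (γ t).1 * metricSpeed (fun t => (γ t).2) t := by
    gcongr
    exact_mod_cast hc t (Ioo_subset_Icc_self hmem)
  refine h1.trans ?_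
  rw [← ENNReal.ofReal_toReal (ht hmem).ne, ← ENNReal.ofReal_coe_nnreal,
    ← ENNReal.ofReal_mul (NNReal.coe_nonneg _)]
  exact ENNReal.ofReal_le_ofReal (hN.right_le ENNReal.toReal_nonneg (by positivity))

lemma edist_fst_le_warpedEDist (hN : IsProductNorm N) (p q : X × Y) :
    edist p.1 q.1 ≤ warpedEDist φ N p q := by
  refine le_sInf ?_
  rintro L ⟨γ, a, b, ⟨hab, h1, -, rfl, rfl⟩, rfl⟩
  exact ac_edist_le_warpedLength_fst hN hab.le h1

lemma edist_snd_le_warpedEDist (hN : IsProductNorm N) {c : ℝ≥0} (hc : ∀ x, c ≤ φ x) (p q : X × Y) :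
    c * edist p.2 q.2 ≤ warpedEDist φ N p q := by
  refine le_sInf ?_
  rintro L ⟨γ, a, b, ⟨hab, -, h2, rfl, rfl⟩, rfl⟩
  exact ac_edist_le_warpedLength_snd hN hab.le h2 fun _ _ => hc _

lemma warpedLength_mono {γ : ℝ → X × Y} {a b c : ℝ} (h : b ≤ c) :
    warpedLength φ N γ a b ≤ warpedLength φ N γ a c :=
  lintegral_mono_set (Ioo_subset_Ioo_right h)

/-- Over the set where `φ > 0`, the warped pseudodistance separates points. -/
lemma eq_of_warpedEDist_eq_zero (hN : IsProductNorm N) (hφ : Continuous φ) {p q : X × Y}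
    (hp : 0 < φ p.1) (h : warpedEDist φ N p q = 0) : p = q := by
  have h1 : p.1 = q.1 := edist_eq_zero.1
    (le_antisymm ((edist_fst_le_warpedEDist hN p q).trans h.le) zero_le)
  set c : ℝ≥0 := φ p.1 / 2 with hc
  have hc0 : 0 < c := half_pos hp
  obtain ⟨δ, hδ, hball⟩ := EMetric.mem_nhds_iff.1
    ((hφ.tendsto p.1).eventually (lt_mem_nhds (NNReal.half_lt_self hp.ne')))
  have key : ∀ ε : ℝ≥0∞, 0 < ε → c * edist p.2 q.2 ≤ ε := by
    intro ε hε
    -- A path of warped length below `δ` keeps its `X`-coordinate in a ball where `φ > c`. Its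
    -- vertical displacement, weighted by `c`, is then at most its warped length, which is below
    -- `ε`.
    have : warpedEDist φ N p q < min ε δ := by rw [h]; exact lt_min hε hδ
    obtain ⟨L, ⟨γ, a, b, ⟨hab, k1, k2, rfl, rfl⟩, rfl⟩, hL⟩ := sInf_lt_iff.1 this
    refine (ac_edist_le_warpedLength_snd hN hab.le k2 fun t ht => ?_).trans
      (hL.le.trans (min_le_left _ _))
    have hmem : (γ t).1 ∈ Metric.eball (γ a).1 δ := by
      rw [Metric.mem_eball, edist_comm]
      exact (ac_edist_le_warpedLength_fst hN ht.1 (k1.mono ht.1 ht.2)).trans_lt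
        ((warpedLength_mono ht.2).trans_lt (hL.trans_le (min_le_right _ _)))
    exact (show c < φ (γ t).1 from hball hmem).le
  have : (c : ℝ≥0∞) * edist p.2 q.2 = 0 :=
    le_antisymm (le_of_forall_pos_le_add fun ε hε => by simpa using key ε hε) zero_le
  rcases mul_eq_zero.1 this with h' | h'
  · exact absurd (by exact_mod_cast h') hc0.ne'
  · exact Prod.ext h1 (edist_eq_zero.1 h')

/-- Lift an almost shortest path of `X` to a path with constant `Y`-coordinate; `φ` does not enter
its length. -/
lemma warpedEDist_horizontal_le (hN : IsProductNorm N) (hX : IsLengthSpace X) (x x' : X) (y : Y) :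
    warpedEDist φ N (x, y) (x', y) ≤ edist x x' := by
  rcases eq_or_ne x x' with rfl | hne
  · rw [warpedEDist_self]; exact zero_le
  refine le_of_forall_gt fun r hr => ?_
  obtain ⟨γ, l, hl, hlr, rfl, rfl, hac, hlip⟩ := hX.exists_path hr
  have hl' : 0 < l := lt_of_le_of_ne hl fun h => hne (by rw [← h])
  refine lt_of_le_of_lt (sInf_le ⟨fun t => (γ t, y), 0, l, ⟨hl', hac, .const _, rfl, rfl⟩, rfl⟩) ?_
  refine lt_of_le_of_lt ?_ hlr
  have : ∀ t ∈ Ioo 0 l, ENNReal.ofReal (warpedSpeed φ N (fun t => (γ t, y)) t) ≤ 1 := by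
    intro t ht
    simp only [warpedSpeed, metricSpeed_const, ENNReal.toReal_zero, mul_zero]
    rw [hN.apply_left ENNReal.toReal_nonneg]
    refine ENNReal.ofReal_toReal_le.trans ?_
    simpa using metricSpeed_le_of_lipschitzOn hlip (Icc_mem_nhds ht.1 ht.2)
  refine (setLIntegral_mono' measurableSet_Ioo this).trans ?_
  simp

/-- Lift an almost shortest path of `Y` to the fibre over `x`, where every length is scaled by the
fixed factor `φ x`. -/
lemma warpedEDist_vertical_le (hN : IsProductNorm N) (hY : IsLengthSpace Y) (x : X) (y y' : Y) :
    warpedEDist φ N (x, y) (x, y') ≤ φ x * edist y y' := by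
  rcases eq_or_ne y y' with rfl | hne
  · rw [warpedEDist_self]; exact zero_le
  have key : ∀ r > edist y y', warpedEDist φ N (x, y) (x, y') ≤ φ x * r := by
    intro r hr
    obtain ⟨γ, l, hl, hlr, rfl, rfl, hac, hlip⟩ := hY.exists_path hr
    have hl' : 0 < l := lt_of_le_of_ne hl fun h => hne (by rw [← h])
    refine le_trans (sInf_le ⟨fun t => (x, γ t), 0, l, ⟨hl', .const _, hac, rfl, rfl⟩, rfl⟩) ?_
    refine le_trans ?_ (mul_le_mul_right hlr.le _)
    have : ∀ t ∈ Ioo 0 l, ENNReal.ofReal (warpedSpeed φ N (fun t => (x, γ t)) t) ≤ φ x := by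
      intro t ht
      simp only [warpedSpeed, metricSpeed_const, ENNReal.toReal_zero]
      rw [hN.apply_right (by positivity), ENNReal.ofReal_mul (NNReal.coe_nonneg _),
        ENNReal.ofReal_coe_nnreal]
      refine mul_le_of_le_one_right' (ENNReal.ofReal_toReal_le.trans ?_)
      simpa using metricSpeed_le_of_lipschitzOn hlip (Icc_mem_nhds ht.1 ht.2)
    refine (setLIntegral_mono' measurableSet_Ioo this).trans ?_
    simp
  -- Almost shortest paths only give the bound for `r > edist y y'`; the limit `r ↓ edist y y'` is
  -- legitimate because `φ x` is finite.
  have h2 : Tendsto (fun r : ℝ≥0∞ => φ x * r) (𝓝[>] (edist y y')) (𝓝 (φ x * edist y y')) :=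
    (ENNReal.Tendsto.const_mul tendsto_id (Or.inr ENNReal.coe_ne_top)).mono_left
      nhdsWithin_le_nhds
  have : (𝓝[>] (edist y y')).NeBot := nhdsGT_neBot_of_exists_gt ⟨∞, (edist_lt_top y y')⟩
  exact ge_of_tendsto h2 (eventually_mem_nhdsWithin.mono key)

/-- Move horizontally first, then vertically over `q.1`. The factor depends on `q` alone, which
yields continuity of the projection at `q`. -/
lemma warpedEDist_le (hN : IsProductNorm N) (hX : IsLengthSpace X) (hY : IsLengthSpace Y)
    (p q : X × Y) : warpedEDist φ N p q ≤ edist p.1 q.1 + φ q.1 * edist p.2 q.2 :=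
  (warpedEDist_triangle p (q.1, p.2) q).trans
    (add_le_add (warpedEDist_horizontal_le hN hX _ _ _) (warpedEDist_vertical_le hN hY _ _ _))

/-- Products of balls are contained in warped balls. -/
lemma prod_eball_subset (hN : IsProductNorm N) (hXlen : IsLengthSpace X) (hYlen : IsLengthSpace Y)
    (x : X) (y : Y) {r s : ℝ} (hr : 0 < r) (hs : 0 < s) :
    Metric.eball x (ENNReal.ofReal r) ×ˢ Metric.eball y (ENNReal.ofReal s) ⊆
      warpedProj φ N ⁻¹' Metric.eball (warpedProj φ N (x, y)) (ENNReal.ofReal (r + φ x * s)) := by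
  rintro ⟨x', y'⟩ ⟨h1, h2⟩
  simp only [mem_preimage, Metric.mem_eball] at h1 h2 ⊢
  rw [edist_warpedProj, ENNReal.ofReal_add hr.le (by positivity),
    ENNReal.ofReal_mul (NNReal.coe_nonneg _), ENNReal.ofReal_coe_nnreal]
  refine (warpedEDist_le hN hXlen hYlen _ _).trans_lt ?_
  exact ENNReal.add_lt_add_of_lt_of_le (by finiteness) h1 (by gcongr)

lemma continuous_warpedProj (hN : IsProductNorm N) (hX : IsLengthSpace X) (hY : IsLengthSpace Y) :
    Continuous (warpedProj (Y := Y) φ N) := by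
  refine continuous_iff_continuousAt.2 fun q => ?_
  rw [ContinuousAt, tendsto_iff_edist_tendsto_0]
  refine tendsto_of_tendsto_of_tendsto_of_le_of_le tendsto_const_nhds ?_ (fun _ => zero_le)
    (fun p => (edist_warpedProj p q).le.trans (warpedEDist_le hN hX hY p q))
  have h1 : Tendsto (fun p : X × Y => edist p.1 q.1) (𝓝 q) (𝓝 0) := by
    have : Continuous fun p : X × Y => edist p.1 q.1 := by fun_prop
    simpa using this.tendsto q
  have h2 : Tendsto (fun p : X × Y => edist p.2 q.2) (𝓝 q) (𝓝 0) := by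
    have : Continuous fun p : X × Y => edist p.2 q.2 := by fun_prop
    simpa using this.tendsto q
  simpa using h1.add (ENNReal.Tendsto.const_mul (a := (φ q.1 : ℝ≥0∞)) h2 (Or.inr ENNReal.coe_ne_top))

lemma surjective_warpedProj : Function.Surjective (warpedProj (Y := Y) φ N) :=
  SeparationQuotient.surjective_mk (X := WarpedPre X Y φ N)

lemma lipschitz_warpedProj_left (hN : IsProductNorm N) (hX : IsLengthSpace X) (y : Y) :
    LipschitzWith 1 fun x => warpedProj φ N (x, y) := fun x x' => by
  rw [edist_warpedProj, ENNReal.coe_one, one_mul]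
  exact warpedEDist_horizontal_le hN hX _ _ _

lemma lipschitz_warpedProj_right (hN : IsProductNorm N) (hY : IsLengthSpace Y) (x : X) :
    LipschitzWith (φ x) fun y : Y => warpedProj φ N (x, y) := fun y y' => by
  rw [edist_warpedProj]
  exact warpedEDist_vertical_le hN hY _ _ _

/-- Upper gradients on the warped product restrict to horizontal slices. -/
lemma IsUpperGradient.horizontal [MeasurableSpace X] [BorelSpace X] (hN : IsProductNorm N)
    (hX : IsLengthSpace X) {u : WarpedProduct X Y φ N → EReal} {g : WarpedProduct X Y φ N → ℝ≥0∞}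
    (h : IsUpperGradient u g) (y : Y) :
    IsUpperGradient (fun x => u (warpedProj φ N (x, y))) fun x => g (warpedProj φ N (x, y)) := by
  have hlip := lipschitz_warpedProj_left (φ := φ) hN hX y
  refine ⟨h.1.comp hlip.continuous.measurable, fun γ a b hab hγ ⟨s, hs, t, ht, hne⟩ => ?_⟩
  refine (h.2 (fun t => warpedProj φ N (γ t, y)) a b hab (hγ.comp_lipschitz hab.le hlip)
    ⟨s, hs, t, ht, fun heq => hne ?_⟩).trans ?_
  · have : warpedEDist φ N (γ s, y) (γ t, y) = 0 := by
      rw [← edist_warpedProj, heq, edist_self]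
    exact edist_eq_zero.1
      (le_antisymm ((edist_fst_le_warpedEDist hN (γ s, y) (γ t, y)).trans this.le) zero_le)
  · refine lintegral_mono fun t => ?_
    have := metricSpeed_comp_le (γ := γ) hlip t
    rw [ENNReal.coe_one, one_mul] at this
    dsimp only
    gcongr

/-- Upper gradients on the warped product restrict to vertical slices, up to the factor `φ`. -/
lemma IsUpperGradient.vertical [MeasurableSpace Y] [BorelSpace Y] (hN : IsProductNorm N)
    (hφ : Continuous φ) (hY : IsLengthSpace Y) {u : WarpedProduct X Y φ N → EReal}
    {g : WarpedProduct X Y φ N → ℝ≥0∞} (h : IsUpperGradient u g) {x : X} (hx : 0 < φ x) :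
    IsUpperGradient (fun y => u (warpedProj φ N (x, y)))
      fun y => φ x * g (warpedProj φ N (x, y)) := by
  have hlip := lipschitz_warpedProj_right (φ := φ) hN hY x
  refine ⟨(h.1.comp hlip.continuous.measurable).const_mul _,
    fun γ a b hab hγ ⟨s, hs, t, ht, hne⟩ => ?_⟩
  refine (h.2 (fun t => warpedProj φ N (x, γ t)) a b hab (hγ.comp_lipschitz hab.le hlip)
    ⟨s, hs, t, ht, fun heq => hne ?_⟩).trans ?_
  -- The image path stays non-constant because `φ x > 0`; over a zero of `φ` the fibre collapses to
  -- a point.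
  · have : warpedEDist φ N (x, γ s) (x, γ t) = 0 := by
      rw [← edist_warpedProj, heq, edist_self]
    exact congrArg Prod.snd (eq_of_warpedEDist_eq_zero hN hφ (p := (x, γ s)) hx this)
  · refine lintegral_mono fun t => ?_
    have := metricSpeed_comp_le (γ := γ) hlip t
    dsimp only
    calc _ ≤ g (warpedProj φ N (x, γ t)) * (φ x * metricSpeed γ t) := by gcongr
      _ = _ := by ring

end WarpedDistance

/-! ### The warped product as a metric measure space -/

section MetricMeasure

lemma IsMetricMeasureSpace.secondCountable {Z : Type*} [MetricSpace Z] [MeasurableSpace Z]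
    {μ : Measure Z} (h : IsMetricMeasureSpace μ) : SecondCountableTopology Z :=
  have := h.separable
  UniformSpace.secondCountable_of_separable Z

lemma IsMetricMeasureSpace.isLocallyFiniteMeasure {Z : Type*} [MetricSpace Z] [MeasurableSpace Z]
    {μ : Measure Z} (h : IsMetricMeasureSpace μ) : IsLocallyFiniteMeasure μ :=
  ⟨fun x => ⟨_, Metric.eball_mem_nhds x (by simp), h.ball_lt_top x 1 one_pos⟩⟩

lemma IsMetricMeasureSpace.sigmaFinite {Z : Type*} [MetricSpace Z] [MeasurableSpace Z]
    {μ : Measure Z} (h : IsMetricMeasureSpace μ) : SigmaFinite μ :=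
  have := h.secondCountable
  have := h.isLocallyFiniteMeasure
  inferInstance

variable {X Y : Type*} [MetricSpace X] [MeasurableSpace X] [BorelSpace X]
  [MetricSpace Y] [MeasurableSpace Y] [BorelSpace Y] {φ : X → ℝ≥0} {N : Seminorm ℝ (ℝ × ℝ)}
  {μX : Measure X} {μY : Measure Y}

lemma measurable_warpedProj (hX : IsMetricMeasureSpace μX) (hXlen : IsLengthSpace X)
    (hYlen : IsLengthSpace Y) (hN : IsProductNorm N) :
    Measurable (warpedProj (Y := Y) φ N) :=
  have := hX.secondCountable
  (continuous_warpedProj hN hXlen hYlen).measurable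

/-- Warped balls contain products of balls, hence have positive measure. They lie over balls of `X`;
in the `Y`-direction they are confined either by the finite mass of `Y` or by a ball of radius `r /
inf φ`. -/
lemma isMetricMeasureSpace_warped (hX : IsMetricMeasureSpace μX) (hXlen : IsLengthSpace X)
    (hY : IsMetricMeasureSpace μY) (hYlen : IsLengthSpace Y) (hN : IsProductNorm N)
    (hφY : μY univ < ∞ ∨ 0 < ⨅ x, φ x) :
    IsMetricMeasureSpace (warpedMeasure φ N μX μY) := by
  have := hX.secondCountable
  have := hY.secondCountable
  have := hX.sigmaFinite
  have := hY.sigmaFinite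
  have hcont := continuous_warpedProj (φ := φ) hN hXlen hYlen
  have hmeas := measurable_warpedProj (φ := φ) hX hXlen hYlen hN
  refine ⟨?_, fun z w => ?_, surjective_warpedProj.denseRange.separableSpace hcont,
    fun z r hr => ?_, fun z r hr => ?_⟩
  · obtain ⟨x⟩ := hX.nonempty
    obtain ⟨y⟩ := hY.nonempty
    exact ⟨warpedProj φ N (x, y)⟩
  · obtain ⟨p, rfl⟩ := surjective_warpedProj z
    obtain ⟨q, rfl⟩ := surjective_warpedProj w
    rw [edist_warpedProj]
    refine ne_top_of_le_ne_top ?_ (warpedEDist_le hN hXlen hYlen p q)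
    finiteness
  · obtain ⟨p, rfl⟩ := surjective_warpedProj z
    rw [warpedMeasure, Measure.map_apply hmeas Metric.isOpen_eball.measurableSet]
    -- The solution of `s + φ p.1 * s = r`, the radius in `prod_eball_subset`.
    set s : ℝ := r / (1 + φ p.1)
    have hs : 0 < s := by positivity
    have hsr : s + φ p.1 * s = r := by
      have : (0 : ℝ) < 1 + φ p.1 := by positivity
      simp only [s]; field_simp
    have hsub := prod_eball_subset (φ := φ) hN hXlen hYlen p.1 p.2 hs hs
    rw [hsr] at hsub
    refine lt_of_lt_of_le ?_ (measure_mono hsub)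
    rw [Measure.prod_prod]
    exact ENNReal.mul_pos (hX.ball_pos _ _ hs).ne' (hY.ball_pos _ _ hs).ne'
  · obtain ⟨p, rfl⟩ := surjective_warpedProj z
    rw [warpedMeasure, Measure.map_apply hmeas Metric.isOpen_eball.measurableSet]
    rcases hφY with hY1 | hφ
    · refine lt_of_le_of_lt (measure_mono (t := Metric.eball p.1 (ENNReal.ofReal r) ×ˢ univ)
        fun q hq => ⟨?_, mem_univ _⟩) ?_
      · rw [mem_preimage, Metric.mem_eball, edist_warpedProj] at hq
        exact (edist_fst_le_warpedEDist hN _ _).trans_lt hq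
      · rw [Measure.prod_prod]
        exact ENNReal.mul_lt_top (hX.ball_lt_top _ _ hr) hY1
    · set c := ⨅ x, φ x
      have hc : (0 : ℝ) < c := hφ
      refine lt_of_le_of_lt (measure_mono (t := Metric.eball p.1 (ENNReal.ofReal r) ×ˢ
        Metric.eball p.2 (ENNReal.ofReal (r / c))) fun q hq => ⟨?_, ?_⟩) ?_
      · rw [mem_preimage, Metric.mem_eball, edist_warpedProj] at hq
        exact (edist_fst_le_warpedEDist hN _ _).trans_lt hq
      · rw [mem_preimage, Metric.mem_eball, edist_warpedProj] at hq
        have := (edist_snd_le_warpedEDist hN (c := c) (fun x => ciInf_le' _ x) q p).trans_lt hq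
        rw [Metric.mem_eball, ENNReal.ofReal_div_of_pos hc, ENNReal.ofReal_coe_nnreal,
          ENNReal.lt_div_iff_mul_lt (by simp [hφ.ne']) (by simp), mul_comm]
        exact this
      · rw [Measure.prod_prod]
        exact ENNReal.mul_lt_top (hX.ball_lt_top _ _ hr) (hY.ball_lt_top _ _ (by positivity))

end MetricMeasure

/-! ### Arithmetic of extended real values -/

section ExtendedReals

lemma measurable_ereal_abs : Measurable EReal.abs := by
  have : EReal.abs = fun x => max x.toENNReal (-x).toENNReal := by
    funext x
    induction x with
    | bot => simp
    | top => simp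
    | coe x =>
      rw [← EReal.coe_neg, EReal.toENNReal_of_ne_top (EReal.coe_ne_top _),
        EReal.toENNReal_of_ne_top (EReal.coe_ne_top _), EReal.abs_def, EReal.toReal_coe,
        EReal.toReal_coe, abs_eq_max_neg, ENNReal.ofReal_max]
  rw [this]
  exact measurable_ereal_toENNReal.max (measurable_ereal_toENNReal.comp measurable_neg)

lemma ereal_abs_add_coe_le (x : EReal) (c : ℝ) : (x + c).abs ≤ x.abs + ENNReal.ofReal |c| := by
  induction x with
  | bot => simp
  | top => simp
  | coe x =>
    rw [← EReal.coe_add, EReal.abs_def, EReal.abs_def,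
      ← ENNReal.ofReal_add (abs_nonneg _) (abs_nonneg _)]
    exact ENNReal.ofReal_le_ofReal (abs_add_le _ _)

/-- Triangle inequality through a possibly infinite intermediate value, for which the right side is
`∞`. -/
lemma ofReal_abs_sub_le (x : EReal) (a b : ℝ) :
    ENNReal.ofReal |a - b| ≤ (x - a).abs + (x - b).abs := by
  induction x with
  | bot => simp
  | top => simp
  | coe x =>
    rw [← EReal.coe_sub, ← EReal.coe_sub, EReal.abs_def, EReal.abs_def,
      ← ENNReal.ofReal_add (abs_nonneg _) (abs_nonneg _), abs_sub_comm x a]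
    exact ENNReal.ofReal_le_ofReal (abs_sub_le _ _ _)

/-- A finite shift does not affect infinite values, so the indeterminate cases agree as well. This
makes upper gradients blind to additive constants. -/
lemma ereal_add_coe_sub_add_coe (x y : EReal) (c : ℝ) : (x + c) - (y + c) = x - y := by
  induction x with
  | bot => simp
  | top =>
    induction y with
    | bot => simp
    | top => simp
    | coe y => simp [← EReal.coe_add]
  | coe x =>
    induction y with
    | bot => simp [← EReal.coe_add]
    | top => simp [← EReal.coe_add]
    | coe y => norm_cast; ring

end ExtendedReals

/-! ### Sobolev classes and additive constants -/

section SobolevClasses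

variable {Z : Type*} [EMetricSpace Z] [MeasurableSpace Z] {μ : Measure Z} {u : Z → EReal}

lemma IsUpperGradient.add_const {g : Z → ℝ≥0∞} (h : IsUpperGradient u g) (c : ℝ) :
    IsUpperGradient (fun z => u z + c) g := by
  refine ⟨h.1, fun γ a b hab hγ hne => ?_⟩
  rw [ereal_add_coe_sub_add_coe]
  exact h.2 γ a b hab hγ hne

lemma IntegrableOverBalls.add_const (hμ : IsMetricMeasureSpace μ) (h : IntegrableOverBalls u μ)
    (c : ℝ) : IntegrableOverBalls (fun z => u z + c) μ := by
  refine ⟨h.1.add_const _, fun x r hr => ?_⟩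
  refine (lintegral_mono fun z => ereal_abs_add_coe_le (u z) c).trans_lt ?_
  rw [lintegral_add_right _ measurable_const, setLIntegral_const]
  exact ENNReal.add_lt_top.2 ⟨h.2 x r hr, ENNReal.mul_lt_top (by simp) (hμ.ball_lt_top x r hr)⟩

lemma dirichletSobolev_add_const {p : ℝ} (hμ : IsMetricMeasureSpace μ)
    (h : u ∈ dirichletSobolev p μ) (c : ℝ) : (fun z => u z + (c : EReal)) ∈ dirichletSobolev p μ :=
  ⟨h.1.add_const hμ c, h.2.imp fun _ hg => ⟨hg.1.add_const c, hg.2⟩⟩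

/-- A Sobolev–Poincaré inequality makes Dirichlet functions Newtonian up to constants. -/
lemma IsSobolevPoincare.dirichletSobolev_eq {p C : ℝ} (hp : 1 ≤ p) (hμ : IsMetricMeasureSpace μ)
    (h : IsSobolevPoincare p p C μ) :
    dirichletSobolev p μ =
      {w | ∃ v ∈ newtonianSobolev p μ, ∃ c : ℝ, w = fun z => v z + (c : EReal)} := by
  ext u
  constructor
  · intro hu
    obtain ⟨g, hg, hgp⟩ := hu.2
    obtain ⟨c, hc⟩ := h.2 u hu g hg hgp
    refine ⟨fun z => u z + ((-c : ℝ) : EReal), ⟨dirichletSobolev_add_const hμ hu (-c), ?_⟩, c, ?_⟩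
    · have hlt := hc.trans_lt (ENNReal.mul_lt_top ENNReal.ofReal_lt_top hgp)
      rw [eLpNorm_lt_top_iff_lintegral_rpow_enorm_lt_top (by simpa using by linarith)
        ENNReal.ofReal_ne_top, ENNReal.toReal_ofReal (by linarith)] at hlt
      simpa [sub_eq_add_neg] using hlt
    · funext z
      rw [add_assoc, ← EReal.coe_add]
      simp
  · rintro ⟨v, hv, c, rfl⟩
    exact dirichletSobolev_add_const hμ hv.1 c

end SobolevClasses

/-! ### Norm inequalities as inequalities of `p`-th power integrals -/

section Lp

/-- Slice inequalities have to be integrated by Tonelli, which acts on `p`-th powers rather than on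
norms. -/
lemma eLpNorm_le_mul_iff {α β : Type*} [MeasurableSpace α] [MeasurableSpace β] {μ : Measure α}
    {ν : Measure β} {f : α → ℝ≥0∞} {g : β → ℝ≥0∞} {p : ℝ} (hp : 0 < p) (C : ℝ≥0∞) :
    eLpNorm f (ENNReal.ofReal p) μ ≤ C * eLpNorm g (ENNReal.ofReal p) ν ↔
      ∫⁻ a, f a ^ p ∂μ ≤ C ^ p * ∫⁻ b, g b ^ p ∂ν := by
  have h0 : ENNReal.ofReal p ≠ 0 := by simpa using hp
  rw [eLpNorm_eq_lintegral_rpow_enorm_toReal h0 ENNReal.ofReal_ne_top,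
    eLpNorm_eq_lintegral_rpow_enorm_toReal h0 ENNReal.ofReal_ne_top, ENNReal.toReal_ofReal hp.le]
  simp only [enorm_eq_self]
  rw [← ENNReal.rpow_le_rpow_iff hp, ENNReal.mul_rpow_of_nonneg _ _ hp.le, ← ENNReal.rpow_mul,
    ← ENNReal.rpow_mul, one_div_mul_cancel hp.ne', ENNReal.rpow_one, ENNReal.rpow_one]

lemma eLpNorm_lt_top_iff_lintegral {α : Type*} [MeasurableSpace α] {μ : Measure α}
    {f : α → ℝ≥0∞} {p : ℝ} (hp : 0 < p) :
    eLpNorm f (ENNReal.ofReal p) μ < ∞ ↔ ∫⁻ a, f a ^ p ∂μ < ∞ := by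
  rw [eLpNorm_lt_top_iff_lintegral_rpow_enorm_lt_top (by simpa using hp)
        ENNReal.ofReal_ne_top, ENNReal.toReal_ofReal hp.le]
  simp

end Lp

/-! ### Slices of functions on products, and constancy almost everywhere -/

section Slices

lemma ae_aemeasurable_slice {α β γ : Type*} [MeasurableSpace α] [MeasurableSpace β]
    [MeasurableSpace γ] {μ : Measure α} {ν : Measure β} [SFinite ν] {f : α × β → γ}
    (hf : AEMeasurable f (μ.prod ν)) : ∀ᵐ x ∂μ, AEMeasurable (fun y => f (x, y)) ν := by
  filter_upwards [Measure.ae_ae_of_ae_prod hf.ae_eq_mk] with x hx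
  exact ⟨fun y => hf.mk f (x, y), hf.measurable_mk.comp measurable_prodMk_left, hx⟩

/-- Almost every slice of a function integrable over products of balls is integrable over balls. -/
lemma ae_integrableOverBalls_slice {X Y : Type*} [MetricSpace X] [MeasurableSpace X] [BorelSpace X]
    [MetricSpace Y] [MeasurableSpace Y] [BorelSpace Y] {μX : Measure X} {μY : Measure Y}
    [SFinite μX] [SFinite μY] [Nonempty X] [Nonempty Y] {U : X × Y → EReal}
    (hU : AEMeasurable U (μX.prod μY))
    (hint : ∀ (x : X) (y : Y) (r : ℝ), 0 < r →
      ∫⁻ q in Metric.eball x (ENNReal.ofReal r) ×ˢ Metric.eball y (ENNReal.ofReal r),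
        (U q).abs ∂(μX.prod μY) < ∞) :
    ∀ᵐ x ∂μX, IntegrableOverBalls (fun y => U (x, y)) μY := by
  obtain ⟨x₀⟩ := ‹Nonempty X›
  obtain ⟨y₀⟩ := ‹Nonempty Y›
  -- Countably many balls about fixed centres absorb all others, so a single null set of `x` serves
  -- every ball of `Y`. The shift `n + 1` keeps the radii positive.
  have hslice : ∀ n : ℕ, ∀ᵐ x ∂μX, x ∈ Metric.eball x₀ (ENNReal.ofReal (n + 1)) →
      ∫⁻ y in Metric.eball y₀ (ENNReal.ofReal (n + 1)), (U (x, y)).abs ∂μY < ∞ := by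
    intro n
    have h := hint x₀ y₀ (n + 1) (by positivity)
    rw [← Measure.prod_restrict] at h
    have hm : AEMeasurable (fun q => (U q).abs)
        ((μX.restrict (Metric.eball x₀ (ENNReal.ofReal (n + 1)))).prod
          (μY.restrict (Metric.eball y₀ (ENNReal.ofReal (n + 1))))) := by
      rw [Measure.prod_restrict]
      exact measurable_ereal_abs.comp_aemeasurable hU.restrict
    rw [lintegral_prod _ hm] at h
    exact (ae_restrict_iff' Metric.isOpen_eball.measurableSet).1
      (ae_lt_top' hm.lintegral_prod_right' h.ne)
  filter_upwards [ae_all_iff.2 hslice, ae_aemeasurable_slice hU] with x hx hxm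
  refine ⟨hxm, fun y r hr => ?_⟩
  obtain ⟨n, hn⟩ := exists_nat_gt (max (dist x x₀) (r + dist y y₀))
  have h1 : dist x x₀ < n + 1 := by linarith [le_max_left (dist x x₀) (r + dist y y₀)]
  have h2 : r + dist y y₀ < n + 1 := by linarith [le_max_right (dist x x₀) (r + dist y y₀)]
  refine lt_of_le_of_lt (lintegral_mono_set ?_) (hx n ?_)
  · rw [Metric.eball_ofReal, Metric.eball_ofReal]
    exact Metric.ball_subset_ball' h2.le
  · rw [Metric.eball_ofReal]
    exact h1

/-- If the columns `U (·, y)` are `L^p`-close to constants `c y` and to a common function `m` with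
respect to a bounded weight of infinite mass, then `c` is almost everywhere constant. -/
lemma ae_const_of_weight {X Y : Type*} [MeasurableSpace X] [MeasurableSpace Y] {μ : Measure X}
    {ν : Measure Y} [SFinite μ] [SFinite ν] {p : ℝ} (hp : 1 ≤ p) {U : X × Y → EReal}
    (hU : AEMeasurable U (μ.prod ν)) {w : X → ℝ≥0∞} (hw : AEMeasurable w μ)
    (hwtop : ∫⁻ x, w x ∂μ = ∞) {K : ℝ≥0∞} (hK : K ≠ ∞) (hwK : ∀ᵐ x ∂μ, w x ≤ K) {m : X → ℝ}
    (hm : AEMeasurable m μ)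
    (h1 : ∫⁻ x, w x * ∫⁻ y, (U (x, y) - (m x : EReal)).abs ^ p ∂ν ∂μ < ∞) {c : Y → ℝ}
    (h2 : ∀ᵐ y ∂ν, ∫⁻ x, (U (x, y) - (c y : EReal)).abs ^ p ∂μ < ∞) :
    ∃ k, ∀ᵐ y ∂ν, c y = k := by
  have hp0 : 0 < p := by linarith
  have hfst : AEMeasurable (fun q : X × Y => w q.1) (μ.prod ν) :=
    hw.comp_quasiMeasurePreserving Measure.quasiMeasurePreserving_fst
  have hmfst : AEMeasurable (fun q : X × Y => m q.1) (μ.prod ν) :=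
    hm.comp_quasiMeasurePreserving Measure.quasiMeasurePreserving_fst
  have hF : AEMeasurable (fun q : X × Y => (U q - (m q.1 : EReal)).abs ^ p) (μ.prod ν) := by
    refine (measurable_ereal_abs.comp_aemeasurable ?_).pow_const p
    simp only [sub_eq_add_neg, ← EReal.coe_neg]
    exact hU.add hmfst.neg.coe_real_ereal
  have hsw : ∫⁻ x, w x * ∫⁻ y, (U (x, y) - (m x : EReal)).abs ^ p ∂ν ∂μ =
      ∫⁻ y, ∫⁻ x, w x * (U (x, y) - (m x : EReal)).abs ^ p ∂μ ∂ν := by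
    rw [← lintegral_lintegral_swap (hfst.mul hF)]
    refine lintegral_congr_ae ?_
    filter_upwards [ae_aemeasurable_slice hF] with x hx
    exact (lintegral_const_mul'' _ hx).symm
  rw [hsw] at h1
  have hrow := ae_lt_top' (hfst.mul hF).lintegral_prod_left' h1.ne
  -- `m` is compared with `c y` through the column `U (·, y)`. The upper bound `K` of the weight
  -- turns the unweighted hypothesis on `c y` into a weighted one; `2 ^ (p - 1)` comes from
  -- convexity of `t ↦ t ^ p`.
  have hcmp : ∀ᵐ y ∂ν, ∫⁻ x, w x * ENNReal.ofReal |m x - c y| ^ p ∂μ < ∞ := by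
    filter_upwards [hrow, h2, ae_aemeasurable_slice (hfst.mul hF).prod_swap] with y hy1 hy2 hy3
    have hy3' : AEMeasurable (fun x => w x * (U (x, y) - (m x : EReal)).abs ^ p) μ := hy3
    have hb : ∫⁻ x, w x * (U (x, y) - (c y : EReal)).abs ^ p ∂μ < ∞ := by
      refine lt_of_le_of_lt (lintegral_mono_ae (hwK.mono fun x hx => mul_le_mul_left hx _)) ?_
      rw [lintegral_const_mul' _ _ hK]
      exact ENNReal.mul_lt_top hK.lt_top hy2
    have hle : ∀ x, w x * ENNReal.ofReal |m x - c y| ^ p ≤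
        2 ^ (p - 1) * (w x * (U (x, y) - (m x : EReal)).abs ^ p +
          w x * (U (x, y) - (c y : EReal)).abs ^ p) := fun x => by
      calc _ ≤ w x * ((U (x, y) - (m x : EReal)).abs + (U (x, y) - (c y : EReal)).abs) ^ p := by
            gcongr; exact ofReal_abs_sub_le _ _ _
        _ ≤ w x * (2 ^ (p - 1) * ((U (x, y) - (m x : EReal)).abs ^ p +
            (U (x, y) - (c y : EReal)).abs ^ p)) := by
            gcongr; exact ENNReal.rpow_add_le_mul_rpow_add_rpow _ _ hp
        _ = _ := by ring
    refine (lintegral_mono hle).trans_lt ?_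
    have h2p : (2 : ℝ≥0∞) ^ (p - 1) ≠ ∞ := ENNReal.rpow_ne_top_of_nonneg (by linarith) (by simp)
    rw [lintegral_const_mul' _ _ h2p, lintegral_add_left' hy3']
    exact ENNReal.mul_lt_top h2p.lt_top (ENNReal.add_lt_top.2 ⟨hy1, hb⟩)
  rcases eq_or_ne ν 0 with rfl | hν
  · exact ⟨0, by simp⟩
  have : NeBot (ae ν) := ae_neBot.2 hν
  obtain ⟨y₀, hy₀⟩ := hcmp.exists
  refine ⟨c y₀, hcmp.mono fun y hy => ?_⟩
  by_contra hne
  -- Two distinct constants close to the same `m` would make the weighted integral of a positive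
  -- constant finite, although the weight has infinite mass.
  have hle : ∀ x, w x * ENNReal.ofReal |c y - c y₀| ^ p ≤
      2 ^ (p - 1) * (w x * ENNReal.ofReal |m x - c y| ^ p +
        w x * ENNReal.ofReal |m x - c y₀| ^ p) := fun x => by
    calc _ ≤ w x * (ENNReal.ofReal |m x - c y| + ENNReal.ofReal |m x - c y₀|) ^ p := by
          gcongr
          rw [← ENNReal.ofReal_add (abs_nonneg _) (abs_nonneg _), abs_sub_comm (m x)]
          exact ENNReal.ofReal_le_ofReal (abs_sub_le _ _ _)
      _ ≤ w x * (2 ^ (p - 1) * (ENNReal.ofReal |m x - c y| ^ p +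
          ENNReal.ofReal |m x - c y₀| ^ p)) := by
          gcongr; exact ENNReal.rpow_add_le_mul_rpow_add_rpow _ _ hp
      _ = _ := by ring
  have hlt : ∫⁻ x, w x * ENNReal.ofReal |c y - c y₀| ^ p ∂μ < ∞ := by
    refine (lintegral_mono hle).trans_lt ?_
    have h2p : (2 : ℝ≥0∞) ^ (p - 1) ≠ ∞ := ENNReal.rpow_ne_top_of_nonneg (by linarith) (by simp)
    have hmeas : AEMeasurable (fun x => w x * ENNReal.ofReal |m x - c y| ^ p) μ :=
      hw.mul (((hm.sub_const (c y)).abs.ennreal_ofReal).pow_const p)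
    rw [lintegral_const_mul' _ _ h2p, lintegral_add_left' hmeas]
    exact ENNReal.mul_lt_top h2p.lt_top (ENNReal.add_lt_top.2 ⟨hy, hy₀⟩)
  rw [lintegral_mul_const'' _ hw, hwtop, ENNReal.top_mul] at hlt
  · exact lt_irrefl _ hlt
  · have : 0 < ENNReal.ofReal |c y - c y₀| := by simpa [sub_eq_zero] using hne
    exact (ENNReal.rpow_pos this ENNReal.ofReal_ne_top).ne'

/-- On a connected space, a locally almost everywhere constant function is almost everywhere
constant. -/
lemma ae_const_of_locally_ae_const {Y β : Type*} [TopologicalSpace Y] [SecondCountableTopology Y]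
    [PreconnectedSpace Y] [Nonempty Y] [MeasurableSpace Y] [OpensMeasurableSpace Y] {ν : Measure Y}
    [ν.IsOpenPosMeasure] {c : Y → β}
    (h : ∀ y, ∃ s : Set Y, IsOpen s ∧ y ∈ s ∧ ∃ k, ∀ᵐ z ∂ν.restrict s, c z = k) :
    ∃ k, ∀ᵐ y ∂ν, c y = k := by
  obtain ⟨y₀⟩ := ‹Nonempty Y›
  obtain ⟨s₀, hs₀, hy₀, k, hk⟩ := h y₀
  -- The points near which `c` takes the fixed value `k` almost everywhere; this set is shown to be
  -- clopen.
  set S : Set Y := {y | ∃ s : Set Y, IsOpen s ∧ y ∈ s ∧ ∀ᵐ z ∂ν.restrict s, c z = k} with hS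
  have hopen : IsOpen S := by
    rw [isOpen_iff_forall_mem_open]
    rintro y ⟨s, hs, hys, hsk⟩
    exact ⟨s, fun z hz => ⟨s, hs, hz, hsk⟩, hs, hys⟩
  have hclosed : IsClosed S := by
    rw [← closure_subset_iff_isClosed]
    intro y hy
    obtain ⟨s, hs, hys, k', hk'⟩ := h y
    obtain ⟨z, hzs, t, ht, hzt, htk⟩ := mem_closure_iff.1 hy s hs hys
    -- The overlap is open and non-empty, hence not null, so some point of it realizes both `k` and
    -- `k'`.
    have hne : ν.restrict (s ∩ t) ≠ 0 := by
      rw [Ne, Measure.restrict_eq_zero]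
      exact ((hs.inter ht).measure_pos ν ⟨z, hzs, hzt⟩).ne'
    have : NeBot (ae (ν.restrict (s ∩ t))) := ae_neBot.2 hne
    obtain ⟨a, ha, ha'⟩ := ((ae_restrict_of_ae_restrict_of_subset inter_subset_left hk').and
      (ae_restrict_of_ae_restrict_of_subset inter_subset_right htk)).exists
    exact ⟨s, hs, hys, by rwa [← ha', ha]⟩
  have huniv : S = univ := IsClopen.eq_univ ⟨hclosed, hopen⟩ ⟨y₀, s₀, hs₀, hy₀, hk⟩
  refine ⟨k, ae_iff.2 (measure_null_of_locally_null _ fun y _ => ?_)⟩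
  obtain ⟨s, hs, hys, hsk⟩ : y ∈ S := huniv ▸ mem_univ y
  refine ⟨{z | ¬ c z = k} ∩ s, inter_mem_nhdsWithin _ (hs.mem_nhds hys), ?_⟩
  have := ae_iff.1 ((ae_restrict_iff' hs.measurableSet).1 hsk)
  refine measure_mono_null (fun z hz => ?_) this
  simpa using ⟨hz.2, hz.1⟩

end Slices

/-! ### The Sobolev–Poincaré inequality on the warped product -/

section Main

/-- Without a joining path the infimum of lengths would be `∞`, while distances in a metric space
are finite. -/
lemma IsLengthSpace.pathConnectedSpace {Z : Type*} [MetricSpace Z] [Nonempty Z]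
    (hZ : IsLengthSpace Z) : PathConnectedSpace Z := by
  refine ⟨‹_›, fun x y => ?_⟩
  have h := edist_lt_top x y
  rw [hZ x y, iInf_lt_iff] at h
  exact ⟨h.choose⟩

variable {X Y : Type*} [MetricSpace X] [MeasurableSpace X] [BorelSpace X]
  [MetricSpace Y] [MeasurableSpace Y] [BorelSpace Y] {φ : X → ℝ≥0} {N : Seminorm ℝ (ℝ × ℝ)}
  {μX : Measure X} {μY : Measure Y} {p : ℝ}

lemma lintegral_prod_eball_lt_top (hX : IsMetricMeasureSpace μX) (hXlen : IsLengthSpace X)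
    (hYlen : IsLengthSpace Y) (hN : IsProductNorm N) {u : WarpedProduct X Y φ N → EReal}
    (hu : IntegrableOverBalls u (warpedMeasure φ N μX μY)) (x : X) (y : Y) {r : ℝ} (hr : 0 < r) :
    ∫⁻ q in Metric.eball x (ENNReal.ofReal r) ×ˢ Metric.eball y (ENNReal.ofReal r),
      (u (warpedProj φ N q)).abs ∂(μX.prod μY) < ∞ := by
  have hmeas := measurable_warpedProj (φ := φ) hX hXlen hYlen hN
  refine (lintegral_mono_set (prod_eball_subset (φ := φ) hN hXlen hYlen x y hr hr)).trans_lt ?_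
  have hball := Metric.isOpen_eball (x := warpedProj φ N (x, y))
    (ε := ENNReal.ofReal (r + φ x * r))
  have h := hu.2 (warpedProj φ N (x, y)) (r + φ x * r) (by positivity)
  rw [warpedMeasure, Measure.restrict_map hmeas hball.measurableSet, lintegral_map'] at h
  · exact h
  · rw [← Measure.restrict_map hmeas hball.measurableSet]
    exact measurable_ereal_abs.comp_aemeasurable hu.1.restrict
  · exact hmeas.aemeasurable

/-- Passes from real powers to `[0, ∞]`-valued ones. Positivity is essential: for `p > 0`, the value
of `0 ^ (-p)` is `0` in `ℝ` but `∞` in `ℝ≥0∞`. -/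
lemma memLp_top_bound_rpow_neg {α : Type*} [MeasurableSpace α] {μ : Measure α} {f : α → ℝ≥0}
    (hf : Measurable f) (hpos : ∀ᵐ x ∂μ, 0 < f x)
    (h1 : MemLp (fun x => (f x : ℝ) ^ (-p)) ∞ μ) (h2 : ¬ MemLp (fun x => (f x : ℝ) ^ (-p)) 1 μ) :
    (∃ K : ℝ≥0∞, K ≠ ∞ ∧ ∀ᵐ x ∂μ, (f x : ℝ≥0∞) ^ (-p) ≤ K) ∧
      ∫⁻ x, (f x : ℝ≥0∞) ^ (-p) ∂μ = ∞ := by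
  have heq : ∀ᵐ x ∂μ, ‖(f x : ℝ) ^ (-p)‖ₑ = (f x : ℝ≥0∞) ^ (-p) := hpos.mono fun x hx => by
    rw [Real.enorm_eq_ofReal (by positivity), ← ENNReal.ofReal_rpow_of_pos (by exact_mod_cast hx),
      ENNReal.ofReal_coe_nnreal]
  constructor
  · refine ⟨_, h1.2.ne, ?_⟩
    rw [eLpNorm_exponent_top]
    filter_upwards [heq, enorm_ae_le_eLpNormEssSup (fun x => (f x : ℝ) ^ (-p)) μ] with x hx hx'
    rwa [← hx]
  · by_contra hne
    refine h2 ⟨?_, ?_⟩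
    · exact (hf.coe_nnreal_real.pow_const _).aestronglyMeasurable
    · rw [eLpNorm_one_eq_lintegral_enorm, lintegral_congr_ae heq]
      exact lt_top_iff_ne_top.2 hne

/-- The optimal constants of the horizontal slices are locally independent of the slice. -/
lemma ae_const_on_eball (hX : IsMetricMeasureSpace μX) (hY : IsMetricMeasureSpace μY)
    (hYlen : IsLengthSpace Y) (hXlen : IsLengthSpace X) (hN : IsProductNorm N) (hp : 1 ≤ p)
    (hφ : Continuous φ) (hφpos : ∀ᵐ x ∂μX, 0 < φ x) (hYP : IsWeakLocalPoincare p p μY)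
    {E : Set X} (hE1 : MemLp (fun x => (φ x : ℝ) ^ (-p)) ∞ (μX.restrict E))
    (hE2 : ¬ MemLp (fun x => (φ x : ℝ) ^ (-p)) 1 (μX.restrict E))
    {u : WarpedProduct X Y φ N → EReal} (hu : IntegrableOverBalls u (warpedMeasure φ N μX μY))
    {g : WarpedProduct X Y φ N → ℝ≥0∞} (hg : IsUpperGradient u g)
    (hgp : ∫⁻ q, g (warpedProj φ N q) ^ p ∂(μX.prod μY) < ∞) {c : Y → ℝ}
    (hc : ∀ᵐ y ∂μY, ∫⁻ x, (u (warpedProj φ N (x, y)) - (c y : EReal)).abs ^ p ∂μX < ∞) (y₀ : Y) :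
    ∃ s : Set Y, IsOpen s ∧ y₀ ∈ s ∧ ∃ k, ∀ᵐ y ∂μY.restrict s, c y = k := by
  have := hX.secondCountable
  have := hX.sigmaFinite
  have := hY.sigmaFinite
  have := hX.nonempty
  have := hY.nonempty
  have hp0 : 0 < p := by linarith
  have hmeas := measurable_warpedProj (φ := φ) hX hXlen hYlen hN
  have hU : AEMeasurable (fun q => u (warpedProj φ N q)) (μX.prod μY) := hu.1.comp_measurable hmeas
  have hG : Measurable fun q : X × Y => g (warpedProj φ N q) ^ p :=
    (hg.1.comp hmeas).pow_const p
  obtain ⟨C, r, hC, hr, hP⟩ := hYP y₀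
  set B := Metric.eball y₀ (ENNReal.ofReal r)
  refine ⟨B, Metric.isOpen_eball, Metric.mem_eball_self (by simpa using hr), ?_⟩
  set m : X → ℝ := fun x => ⨍ y in B, (u (warpedProj φ N (x, y))).toReal ∂μY with hm
  have hUB : AEMeasurable (fun q => u (warpedProj φ N q))
      ((μX.restrict E).prod (μY.restrict B)) := by
    rw [Measure.prod_restrict]; exact hU.restrict
  have hmm : AEMeasurable m (μX.restrict E) := by
    have h1 := (hUB.ereal_toReal.aestronglyMeasurable (f := fun q => (u (warpedProj φ N q)).toReal))
    have h2 := h1.integral_prod_right'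
    simp only [hm, setAverage_eq]
    exact h2.aemeasurable.const_smul (μY.real B)⁻¹
  have hφE : ∀ᵐ x ∂μX.restrict E, 0 < φ x := ae_restrict_of_ae hφpos
  obtain ⟨⟨K, hK, hwK⟩, hwtop⟩ := memLp_top_bound_rpow_neg hφ.measurable hφE hE1 hE2
  have hw : Measurable fun x => (φ x : ℝ≥0∞) ^ (-p) := hφ.measurable.coe_nnreal_ennreal.pow_const _
  -- The weight is `φ ^ (-p)` on `E`, and the second factor is restricted to the Poincaré ball `B`.
  refine ae_const_of_weight hp hUB hw.aemeasurable hwtop hK hwK hmm ?_ ?_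
  -- The vertical upper gradient `φ x * g` contributes `φ x ^ p`, which the weight cancels exactly,
  -- so only `∫ g ^ p` over the fibre remains.
  · have hslice : ∀ᵐ x ∂μX, (φ x : ℝ≥0∞) ^ (-p) * ∫⁻ y in B,
        (u (warpedProj φ N (x, y)) - (m x : EReal)).abs ^ p ∂μY ≤
        ENNReal.ofReal C ^ p * ∫⁻ y, g (warpedProj φ N (x, y)) ^ p ∂μY := by
      filter_upwards [hφpos, ae_integrableOverBalls_slice hU fun x y r hr =>
        lintegral_prod_eball_lt_top hX hXlen hYlen hN hu x y hr] with x hx hxu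
      have h := hP _ hxu _ (hg.vertical hN hφ hYlen hx)
      rw [eLpNorm_le_mul_iff hp0] at h
      simp only [ENNReal.mul_rpow_of_nonneg _ _ hp0.le] at h
      rw [lintegral_const_mul' _ _ (by finiteness)] at h
      calc _ ≤ (φ x : ℝ≥0∞) ^ (-p) * (ENNReal.ofReal C ^ p * (φ x ^ p *
            ∫⁻ y, g (warpedProj φ N (x, y)) ^ p ∂μY)) := by gcongr
        _ = ((φ x : ℝ≥0∞) ^ (-p) * φ x ^ p) * (ENNReal.ofReal C ^ p *
            ∫⁻ y, g (warpedProj φ N (x, y)) ^ p ∂μY) := by ring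
        _ = _ := by
          rw [← ENNReal.rpow_add _ _ (by simpa using hx.ne') (by simp), neg_add_cancel,
            ENNReal.rpow_zero, one_mul]
    refine (lintegral_mono_ae (ae_restrict_of_ae hslice)).trans_lt ?_
    refine (setLIntegral_le_lintegral _ _).trans_lt ?_
    rw [lintegral_const_mul' _ _ (by finiteness), ← lintegral_prod _ hG.aemeasurable]
    exact ENNReal.mul_lt_top (by finiteness) hgp
  · refine ae_restrict_of_ae (hc.mono fun y hy => (setLIntegral_le_lintegral _ _).trans_lt hy)

lemma isSobolevPoincare_warped (hX : IsMetricMeasureSpace μX) (hXlen : IsLengthSpace X)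
    (hY : IsMetricMeasureSpace μY) (hYlen : IsLengthSpace Y) (hN : IsProductNorm N) (hp : 1 ≤ p)
    (hφ : Continuous φ) (hφpos : ∀ᵐ x ∂μX, 0 < φ x) {C : ℝ} (hXSP : IsSobolevPoincare p p C μX)
    (hYP : IsWeakLocalPoincare p p μY) {E : Set X}
    (hE1 : MemLp (fun x => (φ x : ℝ) ^ (-p)) ∞ (μX.restrict E))
    (hE2 : ¬ MemLp (fun x => (φ x : ℝ) ^ (-p)) 1 (μX.restrict E)) :
    IsSobolevPoincare p p C (warpedMeasure φ N μX μY) := by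
  refine ⟨hXSP.1, fun u hu g hg hgp => ?_⟩
  have := hX.secondCountable
  have := hY.secondCountable
  have := hX.sigmaFinite
  have := hY.sigmaFinite
  have := hX.nonempty
  have := hY.nonempty
  have := hYlen.pathConnectedSpace
  have hYpos : μY.IsOpenPosMeasure := by
    refine ⟨fun s hs ⟨y, hy⟩ => ?_⟩
    obtain ⟨ε, hε, hsub⟩ := Metric.isOpen_iff.1 hs y hy
    rw [← Metric.eball_ofReal] at hsub
    exact ((hY.ball_pos y ε hε).trans_le (measure_mono hsub)).ne'
  have hp0 : 0 < p := by linarith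
  have hmeas := measurable_warpedProj (φ := φ) hX hXlen hYlen hN
  have hU : AEMeasurable (fun q => u (warpedProj φ N q)) (μX.prod μY) :=
    hu.1.1.comp_measurable hmeas
  have hG : Measurable fun q : X × Y => g (warpedProj φ N q) ^ p :=
    (hg.1.comp hmeas).pow_const p
  rw [eLpNorm_lt_top_iff_lintegral hp0, warpedMeasure,
    lintegral_map (hg.1.pow_const p) hmeas] at hgp
  have hGslice : ∀ᵐ y ∂μY, ∫⁻ x, g (warpedProj φ N (x, y)) ^ p ∂μX < ∞ := by
    refine ae_lt_top hG.lintegral_prod_left' ?_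
    rw [← lintegral_prod_symm _ hG.aemeasurable]
    exact hgp.ne
  have hint : ∀ᵐ y ∂μY, IntegrableOverBalls (fun x => u (warpedProj φ N (x, y))) μX := by
    -- The slice lemma fixes the first factor, so it is applied on `Y × X`.
    refine ae_integrableOverBalls_slice (U := fun q => u (warpedProj φ N q.swap)) hU.prod_swap
      fun y x r hr => ?_
    have h := lintegral_prod_eball_lt_top hX hXlen hYlen hN hu.1 x y hr
    rw [← Measure.prod_restrict] at h ⊢
    rwa [← Measure.prod_swap,
      show Prod.swap = ⇑(MeasurableEquiv.prodComm (α := Y) (β := X)) from rfl,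
      lintegral_map_equiv] at h
  have hexists : ∀ᵐ y ∂μY, ∃ c : ℝ, ∫⁻ x, (u (warpedProj φ N (x, y)) - (c : EReal)).abs ^ p ∂μX ≤
      ENNReal.ofReal C ^ p * ∫⁻ x, g (warpedProj φ N (x, y)) ^ p ∂μX := by
    filter_upwards [hGslice, hint] with y hy hyu
    have hgy := hg.horizontal hN hXlen y
    have hgy' := (eLpNorm_lt_top_iff_lintegral (μ := μX) hp0).2 hy
    obtain ⟨c, hc⟩ := hXSP.2 _ ⟨hyu, _, hgy, hgy'⟩ _ hgy hgy'
    exact ⟨c, (eLpNorm_le_mul_iff hp0 _).1 hc⟩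
  -- The constants are merely chosen and no measurability in `y` is available; the argument only
  -- needs almost everywhere statements about `c`.
  obtain ⟨c, hc⟩ := hexists.choice
  have hclt : ∀ᵐ y ∂μY, ∫⁻ x, (u (warpedProj φ N (x, y)) - (c y : EReal)).abs ^ p ∂μX < ∞ := by
    filter_upwards [hc, hGslice] with y hy hy'
    exact hy.trans_lt (ENNReal.mul_lt_top (by finiteness) hy')
  obtain ⟨k, hk⟩ := ae_const_of_locally_ae_const fun y₀ =>
    ae_const_on_eball hX hY hYlen hXlen hN hp hφ hφpos hYP hE1 hE2 hu.1 hg hgp hclt y₀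
  refine ⟨k, ?_⟩
  have habs : AEMeasurable (fun z => (u z - (k : EReal)).abs ^ p) (warpedMeasure φ N μX μY) := by
    refine (measurable_ereal_abs.comp_aemeasurable ?_).pow_const p
    simp only [sub_eq_add_neg, ← EReal.coe_neg]
    exact hu.1.1.add_const _
  have habs' : AEMeasurable (fun q => (u (warpedProj φ N q) - (k : EReal)).abs ^ p)
      (μX.prod μY) := habs.comp_measurable hmeas
  -- With `c y = k` almost everywhere, Tonelli with `x` as inner variable reduces the claim to the
  -- horizontal slice inequality, so the constant is unchanged.
  rw [eLpNorm_le_mul_iff hp0, warpedMeasure,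
    lintegral_map' habs hmeas.aemeasurable, lintegral_map (hg.1.pow_const p) hmeas,
    lintegral_prod_symm _ habs', lintegral_prod_symm _ hG.aemeasurable,
    ← lintegral_const_mul' _ _ (by finiteness)]
  refine lintegral_mono_ae ?_
  filter_upwards [hc, hk] with y hy hyk
  rw [hyk] at hy
  exact hy

end Main

end WarpedPI

theorem theorem1p2 {X Y : Type*}
    [MetricSpace X] [MeasurableSpace X] [BorelSpace X]
    [MetricSpace Y] [MeasurableSpace Y] [BorelSpace Y]
    (μX : Measure X) (μY : Measure Y)
    (hX : WarpedPI.IsMetricMeasureSpace μX) (hXlen : WarpedPI.IsLengthSpace X)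
    (hY : WarpedPI.IsMetricMeasureSpace μY) (hYlen : WarpedPI.IsLengthSpace Y)
    (N : Seminorm ℝ (ℝ × ℝ)) (hN : WarpedPI.IsProductNorm N)
    (p : ℝ) (hp : 1 ≤ p)
    (φ : X → ℝ≥0) (hφ : Continuous φ)
    (hφY : (μY univ < ∞ ∧ ∀ᵐ x ∂μX, 0 < φ x) ∨ 0 < ⨅ x, φ x)
    (CX : ℝ) (hXSP : WarpedPI.IsSobolevPoincare p p CX μX) (hXtop : μX univ = ∞)
    (hYP : WarpedPI.IsWeakLocalPoincare p p μY)
    (hE : ∃ E : Set X, NullMeasurableSet E μX ∧ 0 < μX E ∧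
      MemLp (fun x => (φ x : ℝ) ^ (-p)) ∞ (μX.restrict E) ∧
      ¬ MemLp (fun x => (φ x : ℝ) ^ (-p)) 1 (μX.restrict E)) :
    WarpedPI.IsMetricMeasureSpace (WarpedPI.warpedMeasure φ N μX μY) ∧
    WarpedPI.IsSobolevPoincare p p CX (WarpedPI.warpedMeasure φ N μX μY) ∧
    WarpedPI.dirichletSobolev p (WarpedPI.warpedMeasure φ N μX μY) =
      {w | ∃ v ∈ WarpedPI.newtonianSobolev p (WarpedPI.warpedMeasure φ N μX μY), ∃ c : ℝ,
        w = fun z => v z + (c : EReal)} := by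
  obtain ⟨E, -, -, hE1, hE2⟩ := hE
  have hφpos : ∀ᵐ x ∂μX, 0 < φ x := by
    rcases hφY with h | h
    · exact h.2
    · exact Eventually.of_forall fun x => h.trans_le (ciInf_le' _ x)
  have hW := WarpedPI.isMetricMeasureSpace_warped hX hXlen hY hYlen hN (hφY.imp_left And.left)
  have hSP := WarpedPI.isSobolevPoincare_warped (N := N) hX hXlen hY hYlen hN hp hφ hφpos hXSP hYP
    hE1 hE2
  exact ⟨hW, hSP, hSP.dirichletSobolev_eq hp hW⟩
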